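/- Let $A$ be a finite-dimensional algebra over a field $K$; modules are finite-dimensional right $A$-modules, $D=\operatorname{Hom}_K(-,K)$, and $\Omega^{n}(M)$, $\Omega^{-n}(M)$ denote the $n$-th syzygy and cosyzygy of $M$ in a minimal projective, respectively minimal injective, resolution. A module is basic if it has no direct summand $N\oplus N$ with $N$ indecomposable. The dominant dimension of $M$ is the supremum of the $n\ge 0$ such that the first $n$ terms $I_0,\dots,I_{n-1}$ of a minimal injective resolution of $M$ are projective; the codominant dimension of $M$ is the dominant dimension of the left module $D(M)$. Let $\mathrm{Dom}_n$, $\mathrm{Codom}_n$ be the classes of modules of dominant, respectively codominant, dimension at least $n$, and $\mathrm{Proj}_n$, $\mathrm{Inj}_n$ the classes of modules of projective, respectively injective, dimension at most $n$. A tilting module is a module $T$ of finite projective dimension with $\operatorname{Ext}^n_A(T,T)=0$ for all $n\ge 1$ that admits an exact sequence $0\to A\to T_0\to\dots\to T_m\to 0$ with all $T_j\in\operatorname{add}(T)$; a cotilting module is a module $T$ of finite injective dimension with $\operatorname{Ext}^n_A(T,T)=0$ for all $n\ge 1$ that admits an exact sequence $0\to T_m\to\dots\to T_0\to D(A)\to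 0$ with all $T_j\in\operatorname{add}(T)$. Assume that $A$ is basic and is Auslander–Gorenstein of Gorenstein dimension $r$, that is, the left injective dimension, the right injective dimension and the dominant dimension of $A$ all equal $r$, and $r\ge 2$. Let $e\in A$ be an idempotent such that $eA$ is the minimal faithful projective-injective right $A$-module. Let $1\le i\le r$ and let $T$ be a basic module that is both tilting and cotilting, of projective dimension $i$ and injective dimension $r-i$. Then: 1. $T$ has dominant dimension exactly $r-i$ and codominant dimension exactly $i$. 2. $T\cong eA\oplus\Omega^{-i}(A)$. If $i<r$, then also $T\cong eA\oplus\Omega^{r-i}(D(A))$; if $i=r$, then $T\cong D(A)$. 3. In each of the classes $\mathrm{Dom}_{r-i}\cap\mathrm{Codom}_i$, $\mathrm{Proj}_i\cap\mathrm{Codom}_i$ and $\mathrm{Inj}_{r-i}\cap\mathrm{Dom}_{r-i}$, $T$ is, up to isomorphism, the unique basic module that is both tilting and cotilting. -/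

import Mathlib

open CategoryTheory

universe u

namespace AuslanderGorenstein

section Resolutions

variable {R : Type u} [Ring R]

/-- A submodule is essential if it meets every nonzero submodule nontrivially. -/
def IsEssential {M : Type u} [AddCommGroup M] [Module R M] (N : Submodule R M) : Prop :=
  ∀ L : Submodule R M, N ⊓ L = ⊥ → L = ⊥

/-- A submodule is superfluous if it has no proper supplement. -/
def IsSuperfluous {M : Type u} [AddCommGroup M] [Module R M] (N : Submodule R M) : Prop :=
  ∀ L : Submodule R M, N ⊔ L = ⊤ → L = ⊤

/-- A long exact sequence `0 → M → X 0 → X 1 → X 2 → ⋯`. -/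
structure Coresolution (M : ModuleCat.{u} R) where
  X : ℕ → ModuleCat.{u} R
  ι : M →ₗ[R] X 0
  d : ∀ n, X n →ₗ[R] X (n + 1)
  injective_ι : Function.Injective ι
  exact_zero : Function.Exact ι (d 0)
  exact_succ : ∀ n, Function.Exact (d n) (d (n + 1))

/-- A long exact sequence `⋯ → X 2 → X 1 → X 0 → M → 0`. -/
structure Resolution (M : ModuleCat.{u} R) where
  X : ℕ → ModuleCat.{u} R
  π : X 0 →ₗ[R] M
  d : ∀ n, X (n + 1) →ₗ[R] X n
  surjective_π : Function.Surjective π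
  exact_zero : Function.Exact (d 0) π
  exact_succ : ∀ n, Function.Exact (d (n + 1)) (d n)

/-- The coresolution is a minimal injective resolution: its terms are injective, and each of them
is an injective envelope of the image of the incoming map. -/
structure Coresolution.IsMinimalInjective {M : ModuleCat.{u} R} (I : Coresolution M) : Prop where
  injective : ∀ n, Injective (I.X n)
  essential_zero : IsEssential (LinearMap.range I.ι)
  essential_succ : ∀ n, IsEssential (LinearMap.range (I.d n))

/-- The resolution is a minimal projective resolution: its terms are projective, and each of them
is a projective cover of the image of the outgoing map. -/
structure Resolution.IsMinimalProjective {M : ModuleCat.{u} R} (P : Resolution M) : Prop where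
  projective : ∀ n, Projective (P.X n)
  superfluous_zero : IsSuperfluous (LinearMap.ker P.π)
  superfluous_succ : ∀ n, IsSuperfluous (LinearMap.ker (P.d n))

/-- `N ≅ Ω⁻ⁿ(M)`: the module `N` is isomorphic to the kernel of `I n → I (n + 1)` in a minimal
injective resolution `I` of `M`. For `n = 0` this kernel is (the image of) `M`, and for `n ≥ 1` it
is the image of `I (n - 1) → I n`, the cokernel of the preceding map. -/
def IsCosyzygy (n : ℕ) (M N : ModuleCat.{u} R) : Prop :=
  ∃ I : Coresolution M, I.IsMinimalInjective ∧ Nonempty (N ≃ₗ[R] LinearMap.ker (I.d n))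

/-- `N ≅ Ωⁿ(M)`: the module `N` is isomorphic to the cokernel of `P (n + 1) → P n` in a minimal
projective resolution `P` of `M`. For `n = 0` this cokernel is `M`, and for `n ≥ 1` it is the image
of `P n → P (n - 1)`, the kernel of the following map. -/
def IsSyzygy (n : ℕ) (M N : ModuleCat.{u} R) : Prop :=
  ∃ P : Resolution M, P.IsMinimalProjective ∧ Nonempty (N ≃ₗ[R] (P.X n ⧸ LinearMap.range (P.d n)))

/-- The dominant dimension: the supremum of the `n` such that the first `n` terms
`I 0, …, I (n - 1)` of a minimal injective resolution of `M` are projective. -/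
noncomputable def domDim (M : ModuleCat.{u} R) : ℕ∞ :=
  sSup {k : ℕ∞ | ∃ n : ℕ, k = n ∧
    ∃ I : Coresolution M, I.IsMinimalInjective ∧ ∀ j < n, Projective (I.X j)}

/-- No direct summand of `M` is of the form `N ⊕ N` with `N` indecomposable. -/
def IsBasic (M : ModuleCat.{u} R) : Prop :=
  ∀ N : ModuleCat.{u} R, Indecomposable N → IsEmpty (Retract (ModuleCat.of R (N × N)) M)

/-- `M` lies in `add T`: it is a direct summand of a finite direct sum of copies of `T`. -/
def InAdd (T M : ModuleCat.{u} R) : Prop :=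
  ∃ n : ℕ, Nonempty (Retract M (ModuleCat.of R (Fin n → T)))

/-- A faithful module none of whose proper direct summands is faithful. -/
def IsMinimalFaithful (M : Type u) [AddCommGroup M] [Module R M] : Prop :=
  FaithfulSMul R M ∧ ∀ U V : Submodule R M, IsCompl U V → FaithfulSMul R U → U = ⊤

end Resolutions

section Duality

variable (K : Type u) [Field K] {R : Type u} [Ring R] [Algebra K R]

attribute [local instance] ModuleCat.moduleOfAlgebraModule
attribute [local instance] ModuleCat.isScalarTower_of_algebra_moduleCat

/-- The action of `R` on `Hom_K(M, K)` from the right, `(f · a)(x) = f (a x)`. -/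
@[reducible]
noncomputable def dualModule (M : ModuleCat.{u} R) : Module Rᵐᵒᵖ (Module.Dual K M) where
  smul a f :=
    { toFun := fun x => f (a.unop • x)
      map_add' := fun x y => by rw [smul_add, map_add]
      map_smul' := fun c x => by
        rw [smul_comm, map_smul, RingHom.id_apply] }
  one_smul f := LinearMap.ext fun x => congrArg f (one_smul R x)
  mul_smul a b f := LinearMap.ext fun x => congrArg f (mul_smul b.unop a.unop x)
  smul_zero _ := rfl
  smul_add _ _ _ := rfl
  add_smul a b f := LinearMap.ext fun x =>
    (congrArg f (add_smul a.unop b.unop x)).trans (map_add f _ _)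
  zero_smul f := LinearMap.ext fun x => (congrArg f (zero_smul R x)).trans (map_zero f)

/-- The duality `D = Hom_K(-, K)`, from left `R`-modules to right `R`-modules, where `K` acts on an
`R`-module through `K → R`. -/
noncomputable def dual (M : ModuleCat.{u} R) : ModuleCat.{u} Rᵐᵒᵖ :=
  letI := dualModule K M
  ModuleCat.of Rᵐᵒᵖ (Module.Dual K M)

/-- The codominant dimension of `M` is the dominant dimension of `D(M)`. -/
noncomputable def codomDim (M : ModuleCat.{u} R) : ℕ∞ := domDim (dual K M)

end Duality

section Algebras

variable (K : Type u) [Field K] (A : Type u) [Ring A] [Algebra K A]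

/-- The right regular module `A_A`. Right `A`-modules are modules over `Aᵐᵒᵖ`. -/
abbrev rightRegular : ModuleCat.{u} Aᵐᵒᵖ := ModuleCat.of Aᵐᵒᵖ A

/-- The right module `D(A)`, the dual of the left regular module. -/
noncomputable abbrev dualRegular : ModuleCat.{u} Aᵐᵒᵖ := dual K (ModuleCat.of A A)

/-- The right ideal `eA`, as a right `A`-module. -/
abbrev rightIdeal {A : Type u} [Ring A] (e : A) : ModuleCat.{u} Aᵐᵒᵖ :=
  ModuleCat.of Aᵐᵒᵖ (Submodule.span Aᵐᵒᵖ ({e} : Set A))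

/-- The left and right injective dimensions of `A` and the dominant dimension of `A` are all equal
to `r`, and `r ≥ 2`. -/
structure IsAuslanderGorenstein (r : ℕ) : Prop where
  two_le : 2 ≤ r
  injdim_right : injectiveDimension (rightRegular A) = (r : WithBot ℕ∞)
  injdim_left : injectiveDimension (ModuleCat.of A A) = (r : WithBot ℕ∞)
  domDim_eq : domDim (rightRegular A) = r

variable {A}

/-- Tilting right modules, of arbitrary finite projective dimension. -/
structure IsTilting (T : ModuleCat.{u} Aᵐᵒᵖ) : Prop where
  finite : Module.Finite Aᵐᵒᵖ T
  projdim : ∃ n : ℕ, HasProjectiveDimensionLE T n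
  ext_self : ∀ n : ℕ, 1 ≤ n → Subsingleton (Abelian.Ext T T n)
  /-- There is an exact sequence `0 → A → T₀ → ⋯ → Tₙ → 0` with all `Tⱼ` in `add T`. -/
  coresolution : ∃ (C : Coresolution (rightRegular A)) (n : ℕ),
    (∀ j, InAdd T (C.X j)) ∧ ∀ j, n < j → Subsingleton (C.X j)

/-- Cotilting right modules, of arbitrary finite injective dimension. -/
structure IsCotilting (T : ModuleCat.{u} Aᵐᵒᵖ) : Prop where
  finite : Module.Finite Aᵐᵒᵖ T
  injdim : ∃ n : ℕ, HasInjectiveDimensionLE T n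
  ext_self : ∀ n : ℕ, 1 ≤ n → Subsingleton (Abelian.Ext T T n)
  /-- There is an exact sequence `0 → Tₙ → ⋯ → T₀ → D(A) → 0` with all `Tⱼ` in `add T`. -/
  resolution : ∃ (C : Resolution (dualRegular K A)) (n : ℕ),
    (∀ j, InAdd T (C.X j)) ∧ ∀ j, n < j → Subsingleton (C.X j)

/-- Basic tilting-cotilting right modules. -/
structure IsBasicTiltingCotilting (T : ModuleCat.{u} Aᵐᵒᵖ) : Prop where
  basic : IsBasic T
  tilting : IsTilting T
  cotilting : IsCotilting K T

/-- `T` is, up to isomorphism, the unique basic tilting-cotilting module in the class `𝒞`. -/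
def IsUniqueBasicTiltingCotilting (𝒞 : ModuleCat.{u} Aᵐᵒᵖ → Prop) (T : ModuleCat.{u} Aᵐᵒᵖ) :
    Prop :=
  (IsBasicTiltingCotilting K T ∧ 𝒞 T) ∧
    ∀ T' : ModuleCat.{u} Aᵐᵒᵖ, IsBasicTiltingCotilting K T' → 𝒞 T' → Nonempty (T' ≅ T)

/-- The finite dimensional right modules of dominant dimension at least `n`. -/
def Dom (n : ℕ) (M : ModuleCat.{u} Aᵐᵒᵖ) : Prop := Module.Finite Aᵐᵒᵖ M ∧ n ≤ domDim M

/-- The finite dimensional right modules of codominant dimension at least `n`. -/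
def Codom (n : ℕ) (M : ModuleCat.{u} Aᵐᵒᵖ) : Prop := Module.Finite Aᵐᵒᵖ M ∧ n ≤ codomDim K M

/-- The finite dimensional right modules of projective dimension at most `n`. -/
def Proj (n : ℕ) (M : ModuleCat.{u} Aᵐᵒᵖ) : Prop :=
  Module.Finite Aᵐᵒᵖ M ∧ HasProjectiveDimensionLE M n

/-- The finite dimensional right modules of injective dimension at most `n`. -/
def Inj (n : ℕ) (M : ModuleCat.{u} Aᵐᵒᵖ) : Prop :=
  Module.Finite Aᵐᵒᵖ M ∧ HasInjectiveDimensionLE M n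

end Algebras

end AuslanderGorenstein

/-! Let `I` be a minimal injective resolution of `A` and `Yᵢ = Ω⁻ⁱ(A)`. Since the dominant dimension
of `A` is `r`, the terms `I 0, …, I (r - 1)` are projective-injective, hence lie in `add eA`; so
`Yᵢ` has projective dimension at most `i`, and `0 → A → I 0 → ⋯ → I (i - 1) → Yᵢ → 0` coresolves `A`
by `U = eA ⊕ Yᵢ`. Dimension shifting along `I` gives `Ext^k(T, Yᵢ) = 0` for `k ≥ 1` whenever `pd T ≤
i`. In the other direction `Ext^k(Yᵢ, T) = 0` follows from `id T ≤ r - i` by shifting up to `Y_r`,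
or from codominant dimension at least `i` by shifting along a projective-injective resolution of
`T`.

Two self-orthogonal modules of finite projective dimension that both coresolve `A` and have no
extensions in either direction have the same additive closure (`addOf_of_isCoresolvedBy`). As `T` is
basic and `U` is square-free, Krull–Schmidt (`IsSquareFree.nonempty_equiv`) gives `T ≅ U`. Nothing
here is special to the given `T`, whence uniqueness; in the classes defined by dominant dimension,
`pd T' ≤ i` comes from the Gorenstein bound `pd ≤ r` applied to the `(r - i)`-th cosyzygy of `T'`
(`HasDominantDim.projDim_le`).

The lower bounds for the dominant and codominant dimensions are read off `U`. One more
projective-injective term on either side would split the sequences and make `T` projective, against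
`pd T = i ≥ 1`.

For `D(A) ≅ eA ⊕ Y_r`, both sides are square-free and injective, so it suffices that they cogenerate
each other. A submodule `N` of `D(A)` with no maps to `eA ⊕ Y_r` has `Ext^k(N, A) = 0` for all `k ≥
0`, hence no maps to any finitely generated module of finite projective dimension, such as `D(A)`.
Finally, cosyzygies have no projective summands, so the segment of `I` from `Yᵢ` to `Y_r` is also a
minimal projective resolution; this identifies `Yᵢ` with `Ω^(r-i)(D(A))` for `i < r`. -/

namespace AuslanderGorenstein

/-! ### Direct summands, splittings and additive closures. -/

section Retracts

variable {R : Type u} [Ring R]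
variable {M N L M' N' T : Type u} [AddCommGroup M] [Module R M] [AddCommGroup N] [Module R N]
  [AddCommGroup L] [Module R L] [AddCommGroup M'] [Module R M'] [AddCommGroup N'] [Module R N']
  [AddCommGroup T] [Module R T]

variable (R M N) in
/-- `M` is isomorphic to a direct summand of `N`. -/
def IsRetract : Prop := ∃ (s : M →ₗ[R] N) (p : N →ₗ[R] M), ∀ x, p (s x) = x

theorem IsRetract.refl : IsRetract R M M := ⟨.id, .id, fun _ => rfl⟩

theorem IsRetract.trans (h : IsRetract R M N) (h' : IsRetract R N L) : IsRetract R M L := by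
  obtain ⟨s, p, hp⟩ := h
  obtain ⟨s', p', hp'⟩ := h'
  exact ⟨s' ∘ₗ s, p ∘ₗ p', fun x => by simp [hp, hp']⟩

theorem IsRetract.of_equiv (e : M ≃ₗ[R] N) : IsRetract R M N :=
  ⟨e.toLinearMap, e.symm.toLinearMap, fun x => by simp⟩

theorem IsRetract.fst : IsRetract R M (M × N) := ⟨.inl R M N, .fst R M N, fun x => by simp⟩

theorem IsRetract.snd : IsRetract R N (M × N) := ⟨.inr R M N, .snd R M N, fun x => by simp⟩

theorem IsRetract.prodMap (h : IsRetract R M M') (h' : IsRetract R N N') :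
    IsRetract R (M × N) (M' × N') := by
  obtain ⟨s, p, hp⟩ := h
  obtain ⟨s', p', hp'⟩ := h'
  exact ⟨s.prodMap s', p.prodMap p', fun x => by simp [hp, hp']⟩

theorem IsRetract.pi (h : IsRetract R M N) (ι : Type) : IsRetract R (ι → M) (ι → N) := by
  obtain ⟨s, p, hp⟩ := h
  exact ⟨s.compLeft ι, p.compLeft ι, fun x => by ext i; simp [hp]⟩

theorem IsRetract.of_isCompl {U V : Submodule R M} (h : IsCompl U V) : IsRetract R U M := by
  refine ⟨U.subtype, U.projectionOnto V h, fun x => ?_⟩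
  exact Submodule.projectionOnto_apply_left h x

theorem IsRetract.of_injective [Module.Injective R M] (f : M →ₗ[R] N)
    (hf : Function.Injective f) : IsRetract R M N := by
  obtain ⟨g, hg⟩ := Module.Injective.out f hf (LinearMap.id : M →ₗ[R] M)
  exact ⟨f, g, hg⟩

theorem IsRetract.of_surjective [Module.Projective R M] (f : N →ₗ[R] M)
    (hf : Function.Surjective f) : IsRetract R M N := by
  obtain ⟨g, hg⟩ := Module.projective_lifting_property f LinearMap.id hf
  exact ⟨g, f, fun x => LinearMap.congr_fun hg x⟩

theorem IsRetract.projective (h : IsRetract R M N) [Module.Projective R N] :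
    Module.Projective R M := by
  obtain ⟨s, p, hp⟩ := h
  exact Module.Projective.of_split s p (LinearMap.ext hp)

theorem IsRetract.injective (h : IsRetract R M N) [Module.Injective R N] :
    Module.Injective R M := by
  obtain ⟨s, p, hp⟩ := h
  refine ⟨fun X Y _ _ _ _ f hf g => ?_⟩
  obtain ⟨k, hk⟩ := Module.Injective.out f hf (s ∘ₗ g)
  exact ⟨p ∘ₗ k, fun x => by simp [hk, hp]⟩

theorem IsRetract.finite (h : IsRetract R M N) [Module.Finite R N] : Module.Finite R M := by
  obtain ⟨s, p, hp⟩ := h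
  exact Module.Finite.of_surjective p fun x => ⟨s x, hp x⟩

instance injective_prod [Module.Injective R M] [Module.Injective R N] :
    Module.Injective R (M × N) := by
  refine ⟨fun X Y _ _ _ _ f hf g => ?_⟩
  obtain ⟨k, hk⟩ := Module.Injective.out f hf (LinearMap.fst R M N ∘ₗ g)
  obtain ⟨l, hl⟩ := Module.Injective.out f hf (LinearMap.snd R M N ∘ₗ g)
  exact ⟨k.prod l, fun x => by ext <;> simp [hk, hl]⟩

/-- The kernel of the projection onto a direct summand is a complement. -/
theorem exists_equiv_prod_ker {s : M →ₗ[R] N} {p : N →ₗ[R] M} (hp : ∀ x, p (s x) = x) :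
    ∃ e : N ≃ₗ[R] M × LinearMap.ker p, ∀ x, (e x).1 = p x := by
  let q : N →ₗ[R] LinearMap.ker p := LinearMap.codRestrict _ (LinearMap.id - s ∘ₗ p)
    (fun x => by simp [hp])
  refine ⟨LinearEquiv.ofLinearMap (p.prod q) (s.coprod (LinearMap.ker p).subtype) ?_ ?_, fun x => rfl⟩
  · ext x
    · simp [hp]
    · simp [q, hp]
    · simp
    · simp [q]
  · ext x
    simp [q]

theorem IsRetract.exists_equiv_prod (h : IsRetract R M N) :
    ∃ C : Submodule R N, Nonempty (N ≃ₗ[R] M × C) := by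
  obtain ⟨s, p, hp⟩ := h
  obtain ⟨e, -⟩ := exists_equiv_prod_ker hp
  exact ⟨_, ⟨e⟩⟩

/-- A short exact sequence whose first map has a retraction splits. -/
theorem exists_equiv_prod_of_retraction {f : M →ₗ[R] N} {g : N →ₗ[R] L} (hfg : Function.Exact f g)
    (hg : Function.Surjective g) {p : N →ₗ[R] M} (hp : ∀ x, p (f x) = x) :
    Nonempty (N ≃ₗ[R] M × L) := by
  refine ⟨LinearEquiv.ofBijective (p.prod g) ⟨?_, ?_⟩⟩
  · refine (injective_iff_map_eq_zero _).2 fun x hx => ?_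
    have h1 : p x = 0 := congrArg Prod.fst hx
    have h2 : g x = 0 := congrArg Prod.snd hx
    obtain ⟨y, rfl⟩ := (hfg x).1 h2
    rw [hp] at h1
    rw [h1, map_zero]
  · rintro ⟨a, c⟩
    obtain ⟨b, rfl⟩ := hg c
    refine ⟨b + f (a - p b), ?_⟩
    ext
    · simp [hp]
    · simp [hfg.apply_apply_eq_zero]

theorem exists_equiv_prod_of_injective [Module.Injective R M] {f : M →ₗ[R] N} {g : N →ₗ[R] L}
    (hf : Function.Injective f) (hfg : Function.Exact f g) (hg : Function.Surjective g) :
    Nonempty (N ≃ₗ[R] M × L) := by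
  obtain ⟨p, hp⟩ := Module.Injective.out f hf (LinearMap.id : M →ₗ[R] M)
  exact exists_equiv_prod_of_retraction hfg hg hp

theorem exists_equiv_prod_of_projective [Module.Projective R L] {f : M →ₗ[R] N} {g : N →ₗ[R] L}
    (hf : Function.Injective f) (hfg : Function.Exact f g) (hg : Function.Surjective g) :
    Nonempty (N ≃ₗ[R] M × L) := by
  obtain ⟨s, hs⟩ := Module.projective_lifting_property g LinearMap.id hg
  have hs' : ∀ x, g (s x) = x := fun x => LinearMap.congr_fun hs x
  refine ⟨(LinearEquiv.ofBijective (f.coprod s) ⟨?_, ?_⟩).symm⟩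
  · refine (injective_iff_map_eq_zero _).2 ?_
    rintro ⟨a, c⟩ hx
    simp only [LinearMap.coprod_apply] at hx
    have h2 : c = 0 := by
      have := congrArg g hx
      rwa [map_add, hfg.apply_apply_eq_zero, hs', zero_add, map_zero] at this
    subst h2
    rw [map_zero, add_zero] at hx
    rw [hf (hx.trans (map_zero f).symm)]
    rfl
  · intro b
    obtain ⟨a, ha⟩ := (hfg (b - s (g b))).1 (by rw [map_sub, hs', sub_self])
    exact ⟨(a, g b), by simp [ha]⟩

/-- `M` is a direct summand of a finite direct sum of copies of `T`. -/
def AddOf (R T M : Type u) [Ring R] [AddCommGroup T] [Module R T] [AddCommGroup M] [Module R M] :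
    Prop := ∃ n : ℕ, IsRetract R M (Fin n → T)

theorem AddOf.of_finite {ι : Type} [Finite ι] (h : IsRetract R M (ι → T)) : AddOf R T M := by
  obtain ⟨n, ⟨e⟩⟩ := Finite.exists_equiv_fin ι
  exact ⟨n, h.trans (.of_equiv (LinearEquiv.funCongrLeft R T e.symm))⟩

theorem AddOf.of_isRetract (h : IsRetract R M T) : AddOf R T M :=
  .of_finite (ι := Unit) (h.trans (.of_equiv (LinearEquiv.funUnique Unit R T).symm))

theorem AddOf.retract (h : IsRetract R M N) (h' : AddOf R T N) : AddOf R T M := by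
  obtain ⟨n, hn⟩ := h'
  exact ⟨n, h.trans hn⟩

theorem AddOf.pi (h : AddOf R T M) (n : ℕ) : AddOf R T (Fin n → M) := by
  obtain ⟨m, hm⟩ := h
  exact .of_finite (ι := Fin n × Fin m) ((hm.pi (Fin n)).trans
    (.of_equiv (LinearEquiv.curry R T (Fin n) (Fin m)).symm))

theorem AddOf.trans (h : AddOf R N M) (h' : AddOf R T N) : AddOf R T M := by
  obtain ⟨n, hn⟩ := h
  exact .retract hn (h'.pi n)

instance projective_fun (ι : Type) [Fintype ι] [Module.Projective R T] :
    Module.Projective R (ι → T) :=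
  .of_equiv (DirectSum.linearEquivFunOnFintype R ι fun _ => T)

/-- The homomorphisms from `M` to `T` separate the points of `M`. -/
def IsCogeneratedBy (R M T : Type u) [Ring R] [AddCommGroup M] [Module R M] [AddCommGroup T]
    [Module R T] : Prop := ∀ x : M, x ≠ 0 → ∃ f : M →ₗ[R] T, f x ≠ 0

/-- Take a map to a finite power of `T` with minimal kernel: a nonzero kernel element would be
separated by one further coordinate, shrinking the kernel. -/
theorem IsCogeneratedBy.exists_injective [IsArtinian R M] (h : IsCogeneratedBy R M T) :
    ∃ (n : ℕ) (f : M →ₗ[R] (Fin n → T)), Function.Injective f := by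
  obtain ⟨S, ⟨n, f, rfl⟩, hmin⟩ := IsArtinian.set_has_minimal
      {S : Submodule R M | ∃ (n : ℕ) (f : M →ₗ[R] (Fin n → T)), LinearMap.ker f = S}
      ⟨⊤, 0, 0, LinearMap.ker_zero⟩
  refine ⟨n, f, LinearMap.ker_eq_bot.1 ?_⟩
  by_contra hne
  obtain ⟨x, hx, hx0⟩ := Submodule.exists_mem_ne_zero_of_ne_bot hne
  obtain ⟨g, hg⟩ := h x hx0
  let k : M →ₗ[R] (Fin (n + 1) → T) := LinearMap.pi (Fin.cons g fun i => LinearMap.proj i ∘ₗ f)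
  have hk : ∀ y, k y = Fin.cons (g y) (f y) := by
    intro y
    ext i
    refine Fin.cases ?_ (fun i => ?_) i <;> simp [k]
  refine hmin _ ⟨n + 1, k, rfl⟩ (SetLike.lt_iff_le_and_exists.2 ⟨fun y hy => ?_, x, hx, fun hx' => ?_⟩)
  · rw [LinearMap.mem_ker, hk] at hy
    rw [LinearMap.mem_ker]
    ext i
    simpa using congrFun hy i.succ
  · rw [LinearMap.mem_ker, hk] at hx'
    exact hg (by simpa using congrFun hx' 0)

theorem AddOf.of_isCogeneratedBy [IsArtinian R M] [Module.Injective R M]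
    (h : IsCogeneratedBy R M T) : AddOf R T M := by
  obtain ⟨n, f, hf⟩ := h.exists_injective
  exact ⟨n, .of_injective f hf⟩

end Retracts

/-! ### Fitting decompositions, projective covers and injective hulls. -/

section Covers

variable {R : Type u} [Ring R]

/-- Fitting's lemma. The exponent is kept positive so that injectivity of `f ^ n` implies that of
`f`. -/
theorem exists_isCompl_ker_pow {M : Type u} [AddCommGroup M] [Module R M] [IsArtinian R M]
    [IsNoetherian R M] (f : Module.End R M) :
    ∃ n : ℕ, 0 < n ∧ IsCompl (LinearMap.ker (f ^ n)) (LinearMap.range (f ^ n)) := by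
  obtain ⟨N, hN⟩ := Filter.eventually_atTop.1 f.eventually_isCompl_ker_pow_range_pow
  exact ⟨N + 1, N.succ_pos, hN _ N.le_succ⟩

/-- An endomorphism whose stable image has full length is injective. -/
theorem injective_of_length_le_range {M : Type u} [AddCommGroup M] [Module R M]
    [IsArtinian R M] [IsNoetherian R M] (f : Module.End R M)
    (h : ∀ n, 0 < n → IsCompl (LinearMap.ker (f ^ n)) (LinearMap.range (f ^ n)) →
      Module.length R M ≤ Module.length R (LinearMap.range (f ^ n))) :
    Function.Injective f := by
  obtain ⟨n, hn, hc⟩ := exists_isCompl_ker_pow f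
  have htop : LinearMap.range (f ^ n) = ⊤ := by
    by_contra hne
    exact absurd (h n hn hc) (not_le.2 (Submodule.length_lt hne))
  have hbot : LinearMap.ker (f ^ n) = ⊥ := by
    have := hc.disjoint
    rwa [htop, disjoint_top] at this
  obtain ⟨m, rfl⟩ := Nat.exists_eq_succ_of_ne_zero hn.ne'
  have hinj := LinearMap.ker_eq_bot.1 hbot
  intro x y hxy
  apply hinj
  rw [Nat.succ_eq_add_one, pow_succ]
  simp [hxy]

/-- A finitely generated projective of minimal length mapping onto `M` is a cover. If `L`
supplements the kernel, `π` lifts to an endomorphism `f` with image in `L` and `π ∘ f = π`; the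
stable image of `f` is a summand still mapping onto `M`, so by minimality `f` is bijective and `L =
⊤`. -/
theorem exists_projective_cover [IsNoetherianRing R] [IsArtinianRing R] (M : Type u)
    [AddCommGroup M] [Module R M] [Module.Finite R M] :
    ∃ (P : ModuleCat.{u} R) (π : P →ₗ[R] M), Module.Finite R P ∧ Module.Projective R P ∧
      Function.Surjective π ∧ IsSuperfluous (LinearMap.ker π) := by
  let S : Set ℕ∞ := {l | ∃ (P : ModuleCat.{u} R) (π : P →ₗ[R] M), Module.Finite R P ∧
    Module.Projective R P ∧ Function.Surjective π ∧ Module.length R P = l}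
  have hS : S.Nonempty := by
    obtain ⟨n, f, hf⟩ := Module.Finite.exists_fin' R M
    exact ⟨_, ModuleCat.of R (Fin n → R), f, inferInstanceAs (Module.Finite R (Fin n → R)),
      inferInstanceAs (Module.Projective R (Fin n → R)), hf, rfl⟩
  obtain ⟨-, ⟨P, π, hP, hP', hπ, rfl⟩, hmin⟩ := wellFounded_lt.has_min S hS
  refine ⟨P, π, hP, hP', hπ, fun L hL => ?_⟩
  have hsurj : Function.Surjective (π ∘ₗ L.subtype) := by
    intro m
    obtain ⟨p, rfl⟩ := hπ m
    obtain ⟨k, hk, l, hl, rfl⟩ := Submodule.mem_sup.1 (hL.symm ▸ Submodule.mem_top : p ∈ _ ⊔ L)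
    refine ⟨⟨l, hl⟩, ?_⟩
    have hk' : π k = 0 := hk
    simp [hk']
  obtain ⟨g, hg⟩ := Module.projective_lifting_property (π ∘ₗ L.subtype) π hsurj
  let f : Module.End R P := L.subtype ∘ₗ g
  have hf : ∀ x, π (f x) = π x := fun x => LinearMap.congr_fun hg x
  have hfn : ∀ n x, π ((f ^ n) x) = π x := by
    intro n
    induction n with
    | zero => simp
    | succ n ih => intro x; rw [pow_succ']; simp [hf, ih]
  have hinj : Function.Injective f := by
    refine injective_of_length_le_range f fun n _ hc => ?_
    refine not_lt.1 (hmin _ ⟨ModuleCat.of R (LinearMap.range (f ^ n)),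
      π ∘ₗ (LinearMap.range (f ^ n)).subtype, ?_, ?_, ?_, rfl⟩)
    · exact (IsRetract.of_isCompl hc.symm).finite
    · exact (IsRetract.of_isCompl hc.symm).projective
    · intro m
      obtain ⟨p, rfl⟩ := hπ m
      exact ⟨⟨(f ^ n) p, ⟨p, rfl⟩⟩, hfn n p⟩
  have hfs : Function.Surjective f := IsArtinian.surjective_of_injective_endomorphism f hinj
  refine eq_top_iff.2 fun x _ => ?_
  obtain ⟨y, rfl⟩ := hfs x
  exact (g y).2

/-- Dual to projective covers: minimize the length of a finitely generated injective module
containing `M`. If `L` misses `M`, the embedding extends from `E / L` to an endomorphism of `E`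
fixing `M` and killing `L`, and minimality forces it to be injective. -/
theorem exists_injective_hull [IsNoetherianRing R] [IsArtinianRing R] {M : Type u}
    [AddCommGroup M] [Module R M]
    (h : ∃ (E : ModuleCat.{u} R) (ι : M →ₗ[R] E), Module.Finite R E ∧ Module.Injective R E ∧
      Function.Injective ι) :
    ∃ (E : ModuleCat.{u} R) (ι : M →ₗ[R] E), Module.Finite R E ∧ Module.Injective R E ∧
      Function.Injective ι ∧ IsEssential (LinearMap.range ι) := by
  let S : Set ℕ∞ := {l | ∃ (E : ModuleCat.{u} R) (ι : M →ₗ[R] E), Module.Finite R E ∧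
    Module.Injective R E ∧ Function.Injective ι ∧ Module.length R E = l}
  have hS : S.Nonempty := by
    obtain ⟨E, ι, h1, h2, h3⟩ := h
    exact ⟨_, E, ι, h1, h2, h3, rfl⟩
  obtain ⟨-, ⟨E, ι, hE, hE', hι, rfl⟩, hmin⟩ := wellFounded_lt.has_min S hS
  refine ⟨E, ι, hE, hE', hι, fun L hL => ?_⟩
  have hinj : Function.Injective (L.mkQ ∘ₗ ι) := by
    refine (injective_iff_map_eq_zero _).2 fun x hx => ?_
    have hxL : ι x ∈ LinearMap.range ι ⊓ L := ⟨⟨x, rfl⟩, by simpa using hx⟩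
    rw [hL] at hxL
    exact hι (hxL.trans (map_zero ι).symm)
  obtain ⟨g, hg⟩ := Module.Injective.out _ hinj ι
  let f : Module.End R E := g ∘ₗ L.mkQ
  have hf : ∀ x, f (ι x) = ι x := hg
  have hfn : ∀ n x, (f ^ n) (ι x) = ι x := by
    intro n
    induction n with
    | zero => simp
    | succ n ih => intro x; rw [pow_succ']; simp [hf, ih]
  have hinj : Function.Injective f := by
    refine injective_of_length_le_range f fun n _ hc => ?_
    refine not_lt.1 (hmin _ ⟨ModuleCat.of R (LinearMap.range (f ^ n)),
      LinearMap.codRestrict _ ι fun x => ⟨ι x, hfn n x⟩, ?_, ?_, ?_, rfl⟩)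
    · exact (IsRetract.of_isCompl hc.symm).finite
    · exact (IsRetract.of_isCompl hc.symm).injective
    · intro x y hxy
      exact hι (congrArg Subtype.val hxy)
  refine eq_bot_iff.2 fun x hx => ?_
  refine hinj ?_
  have : L.mkQ x = 0 := by simpa using hx
  simp [f, (Submodule.Quotient.mk_eq_zero L).2 hx]

theorem IsEssential.injective_of_comp {M E Q : Type u} [AddCommGroup M] [Module R M]
    [AddCommGroup E] [Module R E] [AddCommGroup Q] [Module R Q] {ι : M →ₗ[R] E}
    (h : IsEssential (LinearMap.range ι)) {g : E →ₗ[R] Q}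
    (hg : Function.Injective (g ∘ₗ ι)) : Function.Injective g := by
  refine LinearMap.ker_eq_bot.1 (h _ (eq_bot_iff.2 ?_))
  rintro _ ⟨⟨x, rfl⟩, hx⟩
  have : x = 0 := hg (by simpa using hx)
  simp [this]

theorem IsSuperfluous.surjective_of_comp {M P Q : Type u} [AddCommGroup M] [Module R M]
    [AddCommGroup P] [Module R P] [AddCommGroup Q] [Module R Q] {π : P →ₗ[R] M}
    (h : IsSuperfluous (LinearMap.ker π)) {g : Q →ₗ[R] P}
    (hg : Function.Surjective (π ∘ₗ g)) : Function.Surjective g := by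
  refine LinearMap.range_eq_top.1 (h _ (eq_top_iff.2 fun x _ => ?_))
  obtain ⟨y, hy⟩ := hg (π x)
  exact Submodule.mem_sup.2 ⟨x - g y, by simpa [sub_eq_zero] using hy.symm, g y, ⟨y, rfl⟩, by simp⟩

theorem IsSuperfluous.map {M N : Type u} [AddCommGroup M] [Module R M] [AddCommGroup N]
    [Module R N] {U : Submodule R M} (h : IsSuperfluous U) (f : M →ₗ[R] N) :
    IsSuperfluous (U.map f) := by
  intro L hL
  have h1 : U ⊔ L.comap f = ⊤ := by
    refine eq_top_iff.2 fun x _ => ?_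
    obtain ⟨-, ⟨u, hu, rfl⟩, l, hl, hx⟩ :=
      Submodule.mem_sup.1 (hL.symm ▸ Submodule.mem_top : f x ∈ U.map f ⊔ L)
    refine Submodule.mem_sup.2 ⟨u, hu, x - u, ?_, by simp⟩
    rw [Submodule.mem_comap, map_sub, ← hx, add_sub_cancel_left]
    exact hl
  have h2 := h _ h1
  have h3 : U.map f ≤ L := by
    rintro _ ⟨u, -, rfl⟩
    exact (h2.symm ▸ Submodule.mem_top : u ∈ L.comap f)
  rwa [sup_eq_right.2 h3] at hL

theorem IsSuperfluous.sup {M : Type u} [AddCommGroup M] [Module R M] {U V : Submodule R M}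
    (h : IsSuperfluous U) (h' : IsSuperfluous V) : IsSuperfluous (U ⊔ V) := fun L hL =>
  h' L (h _ (by rwa [← sup_assoc]))

theorem IsSuperfluous.mono {M : Type u} [AddCommGroup M] [Module R M] {U V : Submodule R M}
    (h : IsSuperfluous V) (h' : U ≤ V) : IsSuperfluous U := fun L hL =>
  h L (eq_top_iff.2 (hL.symm.le.trans (sup_le_sup_right h' L)))

end Covers

/-! ### Krull–Schmidt for square-free modules of finite length. -/

section KrullSchmidt

variable {R : Type u} [Ring R]

/-- An indecomposable module. -/
def IsIndecomposable (R N : Type u) [Ring R] [AddCommGroup N] [Module R N] : Prop :=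
  Nontrivial N ∧ ∀ Y Z : ModuleCat.{u} R, (N ≃ₗ[R] Y × Z) → Subsingleton Y ∨ Subsingleton Z

/-- No nonzero direct summand of `M` is of the form `N ⊕ N`. -/
def IsSquareFree (R M : Type u) [Ring R] [AddCommGroup M] [Module R M] : Prop :=
  ∀ N : ModuleCat.{u} R, IsRetract R (N × N) M → Subsingleton N

theorem IsSquareFree.of_isRetract {M N : Type u} [AddCommGroup M] [Module R M] [AddCommGroup N]
    [Module R N] (h : IsSquareFree R N) (h' : IsRetract R M N) : IsSquareFree R M :=
  fun L hL => h L (hL.trans h')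

variable {M N : Type u} [AddCommGroup M] [Module R M] [AddCommGroup N] [Module R N]

theorem exists_isIndecomposable_isRetract [IsNoetherian R M] [IsArtinian R M] [Nontrivial M] :
    ∃ N : ModuleCat.{u} R, IsIndecomposable R N ∧ IsRetract R N M := by
  let S : Set ℕ∞ := {l | ∃ N : ModuleCat.{u} R, Nontrivial N ∧ IsRetract R N M ∧
    Module.length R N = l}
  obtain ⟨-, ⟨N, hN, hNM, rfl⟩, hmin⟩ := wellFounded_lt.has_min S
    ⟨_, ModuleCat.of R M, ‹_›, .refl, rfl⟩
  refine ⟨N, ⟨hN, fun Y Z e => ?_⟩, hNM⟩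
  by_contra! hYZ
  have h1 : IsRetract R Y N := IsRetract.fst.trans (.of_equiv e.symm)
  obtain ⟨s, p, hp⟩ := hNM
  have hs : Function.Injective s := Function.LeftInverse.injective hp
  have : IsNoetherian R N := isNoetherian_of_injective s hs
  have : IsArtinian R N := isArtinian_of_injective s hs
  have hlt : Module.length R Y < Module.length R N := by
    have hY : Module.length R Y ≠ ⊤ := by
      obtain ⟨s, p, hp⟩ := h1
      have hs : Function.Injective s := Function.LeftInverse.injective hp
      have : IsNoetherian R Y := isNoetherian_of_injective s hs
      have : IsArtinian R Y := isArtinian_of_injective s hs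
      exact Module.length_ne_top
    rw [e.length_eq, Module.length_prod, add_comm]
    have := hYZ.2
    exact ENat.lt_add_left hY (Module.length_pos (R := R) (M := Z))
  exact hmin _ ⟨Y, hYZ.1, h1.trans ⟨s, p, hp⟩, rfl⟩ hlt

variable [IsNoetherian R N] [IsArtinian R N]

theorem IsIndecomposable.bijective_or_isNilpotent (h : IsIndecomposable R N) (f : Module.End R N) :
    Function.Bijective f ∨ IsNilpotent f := by
  obtain ⟨n, hn, hc⟩ := exists_isCompl_ker_pow f
  rcases h.2 (ModuleCat.of R (LinearMap.ker (f ^ n))) (ModuleCat.of R (LinearMap.range (f ^ n)))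
    (Submodule.prodEquivOfIsCompl _ _ hc).symm with h | h
  · left
    have h' : LinearMap.ker (f ^ n) = ⊥ := (Submodule.subsingleton_iff_eq_bot).1 h
    have hinj := LinearMap.ker_eq_bot.1 h'
    obtain ⟨m, rfl⟩ := Nat.exists_eq_succ_of_ne_zero hn.ne'
    refine IsArtinian.bijective_of_injective_endomorphism f fun x y hxy => hinj ?_
    rw [Nat.succ_eq_add_one, pow_succ]
    simp [hxy]
  · right
    exact ⟨n, LinearMap.range_eq_bot.1 ((Submodule.subsingleton_iff_eq_bot).1 h)⟩

/-- The endomorphism ring is local: a nilpotent `f` makes `1 - f` invertible. -/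
theorem IsIndecomposable.bijective_or_of_add (h : IsIndecomposable R N) {f g : Module.End R N}
    (hfg : f + g = 1) : Function.Bijective f ∨ Function.Bijective g := by
  refine (h.bijective_or_isNilpotent f).imp id fun hf => ?_
  have : IsUnit g := by
    rw [← eq_sub_iff_add_eq'] at hfg
    rw [hfg]
    exact hf.isUnit_one_sub
  exact (Module.End.isUnit_iff g).1 this

theorem IsRetract.of_bijective {X : Type u} [AddCommGroup X] [Module R X] {s : M →ₗ[R] X}
    {p : X →ₗ[R] M} (h : Function.Bijective (p ∘ₗ s)) : IsRetract R M X := by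
  refine ⟨s, (LinearEquiv.ofBijective _ h).symm ∘ₗ p, fun x => ?_⟩
  exact (LinearEquiv.ofBijective _ h).symm_apply_apply x

/-- The identity of `N` is the sum of its components through `X` and through `Y`, and one of these
is invertible. -/
theorem IsIndecomposable.isRetract_or (h : IsIndecomposable R N) {X Y : Type u} [AddCommGroup X]
    [Module R X] [AddCommGroup Y] [Module R Y] (hN : IsRetract R N (X × Y)) :
    IsRetract R N X ∨ IsRetract R N Y := by
  obtain ⟨s, p, hp⟩ := hN
  refine (h.bijective_or_of_add (f := (p ∘ₗ .inl R X Y) ∘ₗ (.fst R X Y ∘ₗ s))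
    (g := (p ∘ₗ .inr R X Y) ∘ₗ (.snd R X Y ∘ₗ s)) ?_).imp (fun h => .of_bijective h)
    fun h => .of_bijective h
  ext x
  have : p ((s x).1, 0) + p (0, (s x).2) = p (s x) := by rw [← map_add]; simp
  simpa [hp] using this

theorem IsIndecomposable.isRetract_of_addOf (h : IsIndecomposable R N) {X : Type u}
    [AddCommGroup X] [Module R X] (hN : AddOf R X N) : IsRetract R N X := by
  obtain ⟨n, hn⟩ := hN
  induction n with
  | zero =>
    obtain ⟨s, p, hp⟩ := hn
    have := h.1
    obtain ⟨x, hx⟩ := exists_ne (0 : N)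
    exact absurd (by rw [← hp x, Subsingleton.elim (s x) 0, map_zero]) hx
  | succ n ih =>
    exact (h.isRetract_or (hn.trans (.of_equiv (Fin.consLinearEquiv R fun _ => X).symm))).elim id ih

/-- `C` is the part already matched, and the induction is on the length of the rest `M'`. An
indecomposable summand `K` of `M'` is a summand of `N ≅ C × N'`; it cannot split off `C`, or `K × K`
would be a summand of `M`, so it splits off `N'` and is moved into `C`. -/
theorem IsSquareFree.nonempty_equiv_aux [IsNoetherian R M] [IsArtinian R M]
    (hM : IsSquareFree R M) (hN : IsSquareFree R N) (hMN : AddOf R M N) (hNM : AddOf R N M)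
    (l : ℕ∞) (C M' N' : ModuleCat.{u} R) (hl : Module.length R M' = l) (e : M ≃ₗ[R] C × M')
    (e' : N ≃ₗ[R] C × N') : Nonempty (M ≃ₗ[R] N) := by
  induction l using WellFoundedLT.induction generalizing C M' N' with
  | ind l ih =>
  have instances (X Y : Type u) [AddCommGroup X] [Module R X] [AddCommGroup Y] [Module R Y]
      [IsNoetherian R Y] [IsArtinian R Y] (h : IsRetract R X Y) :
      IsNoetherian R X ∧ IsArtinian R X := by
    obtain ⟨s, p, hp⟩ := h
    have hs : Function.Injective s := Function.LeftInverse.injective hp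
    exact ⟨isNoetherian_of_injective s hs, isArtinian_of_injective s hs⟩
  have hM' : IsRetract R M' M := IsRetract.snd.trans (.of_equiv e.symm)
  have hN' : IsRetract R N' N := IsRetract.snd.trans (.of_equiv e'.symm)
  obtain ⟨_, _⟩ := instances _ _ hM'
  obtain ⟨_, _⟩ := instances _ _ hN'
  rcases subsingleton_or_nontrivial M' with hsub | hnt
  · rcases subsingleton_or_nontrivial N' with hsub' | hnt'
    · let u : (C × M') ≃ₗ[R] (C × N') :=
        (LinearEquiv.refl R C).prodCongr (LinearEquiv.ofSubsingleton M' N')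
      exact ⟨e.trans (u.trans e'.symm)⟩
    · obtain ⟨K, hK, hKN⟩ := exists_isIndecomposable_isRetract (R := R) (M := N')
      obtain ⟨_, _⟩ := instances _ _ hKN
      have hKM : IsRetract R K M := hK.isRetract_of_addOf (hMN.retract (hKN.trans hN'))
      rcases hK.isRetract_or (hKM.trans (.of_equiv e)) with h | h
      · have := hN K ((h.prodMap hKN).trans (.of_equiv e'.symm))
        exact absurd hK.1 (not_nontrivial_iff_subsingleton.2 this)
      · obtain ⟨s, p, hp⟩ := h
        have : Subsingleton K := (Function.LeftInverse.injective hp).subsingleton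
        exact absurd hK.1 (not_nontrivial_iff_subsingleton.2 this)
  · obtain ⟨K, hK, hKM⟩ := exists_isIndecomposable_isRetract (R := R) (M := M')
    obtain ⟨_, _⟩ := instances _ _ hKM
    have hKN : IsRetract R K N := hK.isRetract_of_addOf (hNM.retract (hKM.trans hM'))
    rcases hK.isRetract_or (hKN.trans (.of_equiv e')) with h | h
    · have := hM K ((h.prodMap hKM).trans (.of_equiv e.symm))
      exact absurd hK.1 (not_nontrivial_iff_subsingleton.2 this)
    · obtain ⟨M'', ⟨u⟩⟩ := hKM.exists_equiv_prod
      obtain ⟨N'', ⟨v⟩⟩ := h.exists_equiv_prod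
      have assoc (X : Submodule R M') : (C × (K × X)) ≃ₗ[R] ((C × K) × X) :=
        (LinearEquiv.prodAssoc R C K X).symm
      have assoc' (X : Submodule R N') : (C × (K × X)) ≃ₗ[R] ((C × K) × X) :=
        (LinearEquiv.prodAssoc R C K X).symm
      refine ih (Module.length R M'') ?_ (ModuleCat.of R (C × K)) (ModuleCat.of R M'')
        (ModuleCat.of R N'') rfl (e.trans (((LinearEquiv.refl R C).prodCongr u).trans (assoc _)))
        (e'.trans (((LinearEquiv.refl R C).prodCongr v).trans (assoc' _)))
      rw [← hl, u.length_eq, Module.length_prod]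
      have := hK.1
      exact ENat.lt_add_left (Module.length_ne_top (R := R) (M := M'')) (Module.length_pos (R := R) (M := K))

/-- A square-free module is determined by the direct summands of its finite powers. -/
theorem IsSquareFree.nonempty_equiv [IsNoetherian R M] [IsArtinian R M]
    (hM : IsSquareFree R M) (hN : IsSquareFree R N) (hMN : AddOf R M N) (hNM : AddOf R N M) :
    Nonempty (M ≃ₗ[R] N) :=
  hM.nonempty_equiv_aux hN hMN hNM _ (ModuleCat.of R PUnit) (ModuleCat.of R M) (ModuleCat.of R N)
    rfl (LinearEquiv.uniqueProd (M₂ := PUnit.{u + 1})).symm (LinearEquiv.uniqueProd (M₂ := PUnit.{u + 1})).symm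

theorem IsBasic.isSquareFree {X : ModuleCat.{u} R} [IsNoetherian R X] [IsArtinian R X]
    (h : IsBasic X) : IsSquareFree R X := by
  intro N hN
  by_contra hnt
  rw [not_subsingleton_iff_nontrivial] at hnt
  obtain ⟨s, p, hp⟩ := IsRetract.fst.trans hN
  have hs : Function.Injective s := Function.LeftInverse.injective hp
  have := isNoetherian_of_injective s hs
  have := isArtinian_of_injective s hs
  obtain ⟨K, hK, hKN⟩ := exists_isIndecomposable_isRetract (R := R) (M := N)
  obtain ⟨s, p, hp⟩ := (hKN.prodMap hKN).trans hN
  refine (h K ⟨fun hz => ?_, fun Y Z e => ?_⟩).false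
    ⟨ModuleCat.ofHom s, ModuleCat.ofHom p, by ext1; exact LinearMap.ext hp⟩
  · exact absurd hK.1 (not_nontrivial_iff_subsingleton.2 (ModuleCat.subsingleton_of_isZero hz))
  · exact (hK.2 Y Z (e ≪≫ ModuleCat.biprodIsoProd Y Z).toLinearEquiv).imp
      ModuleCat.isZero_iff_subsingleton.2 ModuleCat.isZero_iff_subsingleton.2

end KrullSchmidt

/-! ### Square-freeness of cokernels of essential embeddings. -/

section SquareFreeCokernel

variable {R : Type u} [Ring R]
variable {K E M : Type u} [AddCommGroup K] [Module R K] [AddCommGroup E] [Module R E]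
  [AddCommGroup M] [Module R M]

/-- `M` has no nonzero projective direct summand. -/
def HasNoProjectiveRetract (R M : Type u) [Ring R] [AddCommGroup M] [Module R M] : Prop :=
  ∀ N : ModuleCat.{u} R, Module.Projective R N → IsRetract R N M → Subsingleton N

/-- A projective summand of `M` would lift to a submodule of `E` meeting the essential image of `K`
trivially. -/
theorem IsEssential.hasNoProjectiveRetract {f : K →ₗ[R] E} {g : E →ₗ[R] M}
    (hfg : Function.Exact f g) (hg : Function.Surjective g)
    (hess : IsEssential (LinearMap.range f)) : HasNoProjectiveRetract R M := by
  rintro N hN ⟨s, p, hp⟩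
  obtain ⟨t, ht⟩ := Module.projective_lifting_property (p ∘ₗ g) LinearMap.id
    (Function.Surjective.comp (g := p) (fun n => ⟨s n, hp n⟩) hg)
  have ht' : ∀ n, p (g (t n)) = n := fun n => LinearMap.congr_fun ht n
  have hrange : LinearMap.range t = ⊥ := by
    refine hess _ (eq_bot_iff.2 ?_)
    rintro _ ⟨⟨k, hk⟩, n, rfl⟩
    have h0 : n = 0 := by rw [← ht' n, ← hk, hfg.apply_apply_eq_zero, map_zero]
    rw [h0, map_zero]
    exact Submodule.zero_mem _
  have ht0 : t = 0 := LinearMap.range_eq_bot.1 hrange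
  have h0 : ∀ n : N, n = 0 := fun n => by rw [← ht' n, ht0]; simp
  exact ⟨fun a b => (h0 a).trans (h0 b).symm⟩

theorem ker_prodMap_eq {P N : Type u} [AddCommGroup P] [Module R P] [AddCommGroup N] [Module R N]
    (π : P →ₗ[R] N) : LinearMap.ker (π.prodMap π) =
      (LinearMap.ker π).map (.inl R P P) ⊔ (LinearMap.ker π).map (.inr R P P) := by
  refine le_antisymm ?_ (sup_le ?_ ?_)
  · rintro ⟨a, b⟩ hab
    obtain ⟨ha, hb⟩ := Prod.mk.inj (hab : (π a, π b) = (0, 0))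
    exact Submodule.mem_sup.2 ⟨(a, 0), ⟨a, ha, rfl⟩, (0, b), ⟨b, hb, rfl⟩, by simp⟩
  · rintro _ ⟨a, ha, rfl⟩
    have ha' : π a = 0 := ha
    simp [ha']
  · rintro _ ⟨a, ha, rfl⟩
    have ha' : π a = 0 := ha
    simp [ha']

variable [IsNoetherianRing R] [IsArtinianRing R]

/-- If `S` supplements the image, `M` maps onto the quotient `Q ⧸ S` and hence onto its projective
cover. That cover is then a projective summand of `M`, so it is zero. -/
theorem HasNoProjectiveRetract.isSuperfluous_range {Q : Type u} [AddCommGroup Q] [Module R Q]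
    [Module.Finite R Q] [Module.Projective R Q] (h : HasNoProjectiveRetract R M)
    (g : M →ₗ[R] Q) : IsSuperfluous (LinearMap.range g) := by
  intro S hS
  obtain ⟨C, κ, _, hC, hκ, hsup⟩ := exists_projective_cover (R := R) (Q ⧸ S)
  obtain ⟨c, hc⟩ := Module.projective_lifting_property κ S.mkQ hκ
  have hcg : Function.Surjective (κ ∘ₗ (c ∘ₗ g)) := by
    intro y
    obtain ⟨q, rfl⟩ := S.mkQ_surjective y
    obtain ⟨-, ⟨m, rfl⟩, x, hx, rfl⟩ :=
      Submodule.mem_sup.1 (hS.symm ▸ Submodule.mem_top : q ∈ LinearMap.range g ⊔ S)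
    refine ⟨m, ?_⟩
    rw [← LinearMap.comp_assoc, hc]
    simpa using hx
  have hsub := h C hC (.of_surjective _ (hsup.surjective_of_comp hcg))
  have : Subsingleton (Q ⧸ S) := hκ.subsingleton
  exact Submodule.Quotient.subsingleton_iff.1 this

/-- Compare the cover `P × P → N × N` with `E → M`. The composite `P × P → E → P × P` covers the
identity of `N × N`, so it is bijective, and restricting to kernels makes `ker π × ker π` a summand
of `K`. Square-freeness of `K` then gives `ker π = 0`. -/
theorem IsSquareFree.projective_of_exact [Module.Projective R E]
    {f : K →ₗ[R] E} {g : E →ₗ[R] M} (hf : Function.Injective f) (hfg : Function.Exact f g)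
    (hg : Function.Surjective g) (hK : IsSquareFree R K) (N : ModuleCat.{u} R)
    [Module.Finite R N] (hN : IsRetract R (N × N) M) : Module.Projective R N := by
  obtain ⟨s, p, hp⟩ := hN
  obtain ⟨P, π, _, _, hπ, hsup⟩ := exists_projective_cover (R := R) N
  let π' : P × P →ₗ[R] N × N := π.prodMap π
  have hπ' : Function.Surjective π' := Function.Surjective.prodMap hπ hπ
  have hsup' : IsSuperfluous (LinearMap.ker π') := by
    rw [ker_prodMap_eq]
    exact (hsup.map _).sup (hsup.map _)
  obtain ⟨α, hα⟩ := Module.projective_lifting_property g (s ∘ₗ π') hg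
  obtain ⟨β, hβ⟩ := Module.projective_lifting_property π' (p ∘ₗ g) hπ'
  have hα' : ∀ x, g (α x) = s (π' x) := fun x => LinearMap.congr_fun hα x
  have hβ' : ∀ x, π' (β x) = p (g x) := fun x => LinearMap.congr_fun hβ x
  have hinj : Function.Injective (β ∘ₗ α) := by
    refine IsNoetherian.injective_of_surjective_endomorphism _
      (hsup'.surjective_of_comp fun y => ?_)
    obtain ⟨x, rfl⟩ := hπ' y
    exact ⟨x, by simp [hβ', hα', hp]⟩
  let L := LinearMap.ker π'
  let fe := LinearEquiv.ofInjective f hf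
  have hfe : ∀ y, f (fe.symm y) = y := fun y => by
    rw [← LinearEquiv.ofInjective_apply (h := hf) f, LinearEquiv.apply_symm_apply]
  let a : L →ₗ[R] K := fe.symm.toLinearMap ∘ₗ LinearMap.codRestrict _ (α ∘ₗ L.subtype) fun x =>
    (hfg _).1 (by
      have : π' x = 0 := x.2
      simp [hα', this])
  let b : K →ₗ[R] L := LinearMap.codRestrict _ (β ∘ₗ f) fun x => by
    rw [LinearMap.mem_ker, LinearMap.comp_apply, hβ', hfg.apply_apply_eq_zero, map_zero]
  have hab : ∀ x : L, (b (a x) : P × P) = β (α x) := fun x => by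
    change β (f (fe.symm _)) = _
    rw [hfe]
    rfl
  have hbij : Function.Bijective (b ∘ₗ a) :=
    IsArtinian.bijective_of_injective_endomorphism _ fun x y hxy =>
      Subtype.ext (hinj (by simpa [← hab] using congrArg Subtype.val hxy))
  have hker : IsRetract R (LinearMap.ker π × LinearMap.ker π) L := by
    refine ⟨LinearMap.codRestrict _ ((LinearMap.ker π).subtype.prodMap (LinearMap.ker π).subtype)
      fun x => ?_, (LinearMap.codRestrict _ (.fst R P P ∘ₗ L.subtype) fun x => ?_).prod
      (LinearMap.codRestrict _ (.snd R P P ∘ₗ L.subtype) fun x => ?_), fun x => ?_⟩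
    · simp [L, π']
    · exact congrArg Prod.fst x.2
    · exact congrArg Prod.snd x.2
    · rfl
  have hsub : Subsingleton (LinearMap.ker π) :=
    hK (ModuleCat.of R (LinearMap.ker π)) (hker.trans (.of_bijective hbij))
  have hπi : Function.Injective π := LinearMap.ker_eq_bot.1 (Submodule.subsingleton_iff_eq_bot.1 hsub)
  exact Module.Projective.of_equiv (LinearEquiv.ofBijective π ⟨hπi, hπ⟩)

theorem IsSquareFree.of_exact [Module.Projective R E] [Module.Finite R M]
    {f : K →ₗ[R] E} {g : E →ₗ[R] M} (hf : Function.Injective f) (hfg : Function.Exact f g)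
    (hg : Function.Surjective g) (hess : IsEssential (LinearMap.range f))
    (hK : IsSquareFree R K) : IsSquareFree R M := by
  intro N hN
  have hN1 : IsRetract R N M := IsRetract.fst.trans hN
  have := hN1.finite
  exact hess.hasNoProjectiveRetract hfg hg N (hK.projective_of_exact hf hfg hg N hN) hN1

/-- A square summand `N × N` is projective by the comparison of kernels, applied with middle term `Q
× E`. The component from `M` then has superfluous image, so `Q` alone maps onto `N × N`, and this
splits. -/
theorem IsSquareFree.prod_of_exact {Q : Type u} [AddCommGroup Q] [Module R Q] [Module.Finite R Q]
    [Module.Projective R Q] [Module.Projective R E] [Module.Finite R M]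
    {f : K →ₗ[R] E} {g : E →ₗ[R] M} (hf : Function.Injective f) (hfg : Function.Exact f g)
    (hg : Function.Surjective g) (hess : IsEssential (LinearMap.range f))
    (hK : IsSquareFree R K) (hQ : IsSquareFree R Q) : IsSquareFree R (Q × M) := by
  intro N hN
  have hN1 : IsRetract R N (Q × M) := IsRetract.fst.trans hN
  have := hN1.finite
  have hproj : Module.Projective R N := by
    refine hK.projective_of_exact (f := .inr R Q E ∘ₗ f) (g := (LinearMap.id (M := Q)).prodMap g)
      ?_ ?_ ?_ N hN
    · exact LinearMap.inr_injective.comp hf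
    · rintro ⟨q, x⟩
      constructor
      · intro h
        obtain ⟨h1, h2⟩ := Prod.mk.inj (h : (q, g x) = (0, 0))
        obtain ⟨k, rfl⟩ := (hfg x).1 h2
        exact ⟨k, Prod.ext (Eq.symm h1) rfl⟩
      · rintro ⟨k, hk⟩
        obtain ⟨h1, h2⟩ := Prod.mk.inj (hk : ((0 : Q), f k) = (q, x))
        simp [← h1, ← h2, hfg.apply_apply_eq_zero]
    · exact Function.Surjective.prodMap Function.surjective_id hg
  obtain ⟨s, p, hp⟩ := hN
  have hsup := (hess.hasNoProjectiveRetract hfg hg).isSuperfluous_range (p ∘ₗ .inr R Q M)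
  have hQN : LinearMap.range (p ∘ₗ .inl R Q M) = ⊤ := by
    refine hsup _ (eq_top_iff.2 fun x _ => Submodule.mem_sup.2
      ⟨p (0, (s x).2), ⟨(s x).2, rfl⟩, p ((s x).1, 0), ⟨(s x).1, rfl⟩, ?_⟩)
    rw [← map_add]
    simp [hp]
  exact hQ N (.of_surjective _ (LinearMap.range_eq_top.1 hQN))

end SquareFreeCokernel

/-! ### Vanishing of Ext in short exact sequences, and homological dimensions. -/

section ExtVanishing

variable {R : Type u} [Ring R] {X Y Z W : ModuleCat.{u} R}

theorem shortExact_of_exact {f : X →ₗ[R] Y} {g : Y →ₗ[R] Z} (hf : Function.Injective f)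
    (hfg : Function.Exact f g) (hg : Function.Surjective g) :
    (ModuleCat.shortComplexOfCompEqZero f g hfg.linearMap_comp_eq_zero).ShortExact :=
  ModuleCat.shortComplex_shortExact _ hfg hf hg

/-- There is a short exact sequence `0 → X → Y → Z → 0`. -/
def IsExtension (X Y Z : ModuleCat.{u} R) : Prop :=
  ∃ (f : X →ₗ[R] Y) (g : Y →ₗ[R] Z), Function.Injective f ∧ Function.Exact f g ∧
    Function.Surjective g

theorem isExtension_ker {f : X →ₗ[R] Y} (hf : Function.Surjective f) :
    IsExtension (ModuleCat.of R (LinearMap.ker f)) X Y :=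
  ⟨(LinearMap.ker f).subtype, f, Submodule.subtype_injective _, LinearMap.exact_subtype_ker_map f, hf⟩

theorem isExtension_coker {f : X →ₗ[R] Y} (hf : Function.Injective f) :
    IsExtension X Y (ModuleCat.of R (Y ⧸ LinearMap.range f)) :=
  ⟨f, (LinearMap.range f).mkQ, hf, LinearMap.exact_map_mkQ_range f, Submodule.mkQ_surjective _⟩

theorem IsExtension.prod (M N : ModuleCat.{u} R) :
    IsExtension M (ModuleCat.of R (M × N)) N :=
  ⟨.inl R M N, .snd R M N, LinearMap.inl_injective, .inl_snd, LinearMap.snd_surjective⟩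

theorem IsExtension.of_equiv_left {X' : ModuleCat.{u} R} (h : IsExtension X Y Z) (e : X' ≃ₗ[R] X) :
    IsExtension X' Y Z := by
  obtain ⟨f, g, hf, hfg, hg⟩ := h
  refine ⟨f ∘ₗ e.toLinearMap, g, hf.comp e.injective, fun y => ?_, hg⟩
  rw [hfg y]
  exact ⟨fun ⟨x, hx⟩ => ⟨e.symm x, by simp [hx]⟩, fun ⟨x, hx⟩ => ⟨e x, hx⟩⟩

theorem IsExtension.of_equiv_mid {Y' : ModuleCat.{u} R} (h : IsExtension X Y Z) (e : Y' ≃ₗ[R] Y) :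
    IsExtension X Y' Z := by
  obtain ⟨f, g, hf, hfg, hg⟩ := h
  refine ⟨e.symm.toLinearMap ∘ₗ f, g ∘ₗ e.toLinearMap, e.symm.injective.comp hf, fun y => ?_,
    hg.comp e.surjective⟩
  refine (hfg (e y)).trans ⟨fun ⟨x, hx⟩ => ⟨x, ?_⟩, fun ⟨x, hx⟩ => ⟨x, ?_⟩⟩
  · simp [hx]
  · simp [← hx]

theorem IsExtension.of_equiv_right {Z' : ModuleCat.{u} R} (h : IsExtension X Y Z)
    (e : Z ≃ₗ[R] Z') : IsExtension X Y Z' := by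
  obtain ⟨f, g, hf, hfg, hg⟩ := h
  refine ⟨f, e.toLinearMap ∘ₗ g, hf, fun y => ?_, e.surjective.comp hg⟩
  simp only [LinearMap.comp_apply, LinearEquiv.coe_coe, EmbeddingLike.map_eq_zero_iff]
  exact hfg y

theorem IsExtension.finite_right (h : IsExtension X Y Z) [Module.Finite R Y] :
    Module.Finite R Z := by
  obtain ⟨f, g, hf, hfg, hg⟩ := h
  exact .of_surjective g hg

theorem IsExtension.finite_left (h : IsExtension X Y Z) [IsNoetherianRing R] [Module.Finite R Y] :
    Module.Finite R X := by
  obtain ⟨f, g, hf, hfg, hg⟩ := h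
  exact .of_injective f hf

theorem projective_iff {P : ModuleCat.{u} R} : Projective P ↔ Module.Projective R P :=
  (IsProjective.iff_projective P).symm

theorem injective_iff {Q : ModuleCat.{u} R} : Injective Q ↔ Module.Injective R Q :=
  (Module.injective_iff_injective_object R Q).symm

/-- The group `Ext^n(X, Y)` vanishes. -/
abbrev ExtZero (X Y : ModuleCat.{u} R) (n : ℕ) : Prop := Subsingleton (Abelian.Ext X Y n)

theorem extZero_iff {n : ℕ} : ExtZero X Y n ↔ ∀ x : Abelian.Ext X Y n, x = 0 :=
  ⟨fun _ x => Subsingleton.elim x 0, fun h => ⟨fun a b => (h a).trans (h b).symm⟩⟩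

theorem extZero_zero_iff : ExtZero X Y 0 ↔ ∀ f : X →ₗ[R] Y, f = 0 := by
  refine ⟨fun h f => ?_, fun h => ?_⟩
  · have : Subsingleton (X ⟶ Y) := Abelian.Ext.addEquiv₀.symm.injective.subsingleton
    have h0 : ModuleCat.ofHom f = 0 := Subsingleton.elim _ _
    simpa using congrArg ModuleCat.Hom.hom h0
  · have : Subsingleton (X ⟶ Y) := ⟨fun a b => by ext1; rw [h a.hom, h b.hom]⟩
    exact Abelian.Ext.addEquiv₀.injective.subsingleton

theorem extZero_of_projective [Module.Projective R X] (n : ℕ) : ExtZero X Y (n + 1) := by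
  have := projective_iff.2 ‹Module.Projective R X›
  exact extZero_iff.2 fun x => x.eq_zero_of_projective

theorem extZero_of_injective [Module.Injective R Y] (n : ℕ) : ExtZero X Y (n + 1) := by
  have := injective_iff.2 ‹Module.Injective R Y›
  exact extZero_iff.2 fun x => x.eq_zero_of_injective

theorem IsExtension.extZero_left (h : IsExtension X Y Z) {n : ℕ} (h1 : ExtZero W Z n)
    (h2 : ExtZero W Y (n + 1)) : ExtZero W X (n + 1) := by
  obtain ⟨f, g, hf, hfg, hg⟩ := h
  refine extZero_iff.2 fun x => ?_
  obtain ⟨y, rfl⟩ := Abelian.Ext.covariant_sequence_exact₁ W (shortExact_of_exact hf hfg hg) x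
    (Subsingleton.elim _ _) rfl
  rw [extZero_iff.1 h1 y, Abelian.Ext.zero_comp]

theorem IsExtension.extZero_mid (h : IsExtension X Y Z) {n : ℕ} (h1 : ExtZero W X n)
    (h2 : ExtZero W Z n) : ExtZero W Y n := by
  obtain ⟨f, g, hf, hfg, hg⟩ := h
  refine extZero_iff.2 fun x => ?_
  obtain ⟨y, rfl⟩ := Abelian.Ext.covariant_sequence_exact₂ W (shortExact_of_exact hf hfg hg) x
    (Subsingleton.elim _ _)
  rw [extZero_iff.1 h1 y, Abelian.Ext.zero_comp]

theorem IsExtension.extZero_right (h : IsExtension X Y Z) {n : ℕ} (h1 : ExtZero W Y n)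
    (h2 : ExtZero W X (n + 1)) : ExtZero W Z n := by
  obtain ⟨f, g, hf, hfg, hg⟩ := h
  refine extZero_iff.2 fun x => ?_
  obtain ⟨y, rfl⟩ := Abelian.Ext.covariant_sequence_exact₃ W (shortExact_of_exact hf hfg hg) x rfl
    (Subsingleton.elim _ _)
  rw [extZero_iff.1 h1 y, Abelian.Ext.zero_comp]

theorem IsExtension.extZero_mid' (h : IsExtension X Y Z) {n : ℕ} (h1 : ExtZero X W n)
    (h2 : ExtZero Z W n) : ExtZero Y W n := by
  obtain ⟨f, g, hf, hfg, hg⟩ := h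
  refine extZero_iff.2 fun x => ?_
  obtain ⟨y, rfl⟩ := Abelian.Ext.contravariant_sequence_exact₂ (shortExact_of_exact hf hfg hg) W x
    (Subsingleton.elim _ _)
  rw [extZero_iff.1 h2 y, Abelian.Ext.comp_zero]

theorem IsExtension.extZero_left' (h : IsExtension X Y Z) {n : ℕ} (h1 : ExtZero Y W n)
    (h2 : ExtZero Z W (n + 1)) : ExtZero X W n := by
  obtain ⟨f, g, hf, hfg, hg⟩ := h
  refine extZero_iff.2 fun x => ?_
  obtain ⟨y, rfl⟩ := Abelian.Ext.contravariant_sequence_exact₁ (shortExact_of_exact hf hfg hg) W x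
    (add_comm 1 n) (Subsingleton.elim _ _)
  rw [extZero_iff.1 h1 y, Abelian.Ext.comp_zero]

/-- Dimension shift along a sequence with injective middle term. -/
theorem IsExtension.extZero_shift (h : IsExtension X Y Z) [Module.Injective R Y] {n : ℕ}
    (h1 : ExtZero W X (n + 2)) : ExtZero W Z (n + 1) :=
  h.extZero_right (extZero_of_injective n) h1

/-- Dimension shift along a sequence with projective middle term. -/
theorem IsExtension.extZero_shift' (h : IsExtension X Y Z) [Module.Projective R Y] {n : ℕ}
    (h1 : ExtZero Z W (n + 2)) : ExtZero X W (n + 1) :=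
  h.extZero_left' (extZero_of_projective n) h1

theorem ExtZero.retract_left {n : ℕ} (h : ExtZero Y W n) (hX : IsRetract R X Y) :
    ExtZero X W n := by
  obtain ⟨s, p, hp⟩ := hX
  refine extZero_iff.2 fun x => ?_
  have hsp : ModuleCat.ofHom s ≫ ModuleCat.ofHom p = 𝟙 X := by ext1; exact LinearMap.ext hp
  rw [← x.mk₀_id_comp, ← hsp, ← Abelian.Ext.mk₀_comp_mk₀_assoc, 
    extZero_iff.1 h ((Abelian.Ext.mk₀ (ModuleCat.ofHom p)).comp x (zero_add n)), Abelian.Ext.comp_zero]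

theorem ExtZero.retract_right {n : ℕ} (h : ExtZero W Y n) (hX : IsRetract R X Y) :
    ExtZero W X n := by
  obtain ⟨s, p, hp⟩ := hX
  refine extZero_iff.2 fun x => ?_
  have hsp : ModuleCat.ofHom s ≫ ModuleCat.ofHom p = 𝟙 X := by ext1; exact LinearMap.ext hp
  rw [← x.comp_mk₀_id, ← hsp, ← Abelian.Ext.mk₀_comp_mk₀, ← Abelian.Ext.comp_assoc_of_second_deg_zero,
    extZero_iff.1 h (x.comp (Abelian.Ext.mk₀ (ModuleCat.ofHom s)) (add_zero n)), Abelian.Ext.zero_comp]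

theorem isExtension_fin_succ (T : ModuleCat.{u} R) (m : ℕ) :
    IsExtension T (ModuleCat.of R (Fin (m + 1) → T)) (ModuleCat.of R (Fin m → T)) :=
  (IsExtension.prod T (ModuleCat.of R (Fin m → T))).of_equiv_mid
    (Fin.consLinearEquiv R fun _ => T).symm

theorem ExtZero.addOf_left {n : ℕ} (h : ExtZero Y W n) (hX : AddOf R Y X) : ExtZero X W n := by
  obtain ⟨m, hm⟩ := hX
  refine ExtZero.retract_left (Y := ModuleCat.of R (Fin m → Y)) ?_ hm
  clear hm
  induction m with
  | zero =>
    refine ExtZero.retract_left h ⟨0, 0, fun x => Subsingleton.elim _ _⟩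
  | succ m ih => exact (isExtension_fin_succ Y m).extZero_mid' h ih

theorem ExtZero.addOf_right {n : ℕ} (h : ExtZero W Y n) (hX : AddOf R Y X) : ExtZero W X n := by
  obtain ⟨m, hm⟩ := hX
  refine ExtZero.retract_right (Y := ModuleCat.of R (Fin m → Y)) ?_ hm
  clear hm
  induction m with
  | zero =>
    refine ExtZero.retract_right h ⟨0, 0, fun x => Subsingleton.elim _ _⟩
  | succ m ih => exact (isExtension_fin_succ Y m).extZero_mid h ih

theorem exists_extension {f : X →ₗ[R] Y} {g : Y →ₗ[R] Z} (hf : Function.Injective f)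
    (hfg : Function.Exact f g) (hg : Function.Surjective g) (h : ExtZero Z W 1) (k : X →ₗ[R] W) :
    ∃ l : Y →ₗ[R] W, ∀ x, l (f x) = k x := by
  obtain ⟨y, hy⟩ := Abelian.Ext.contravariant_sequence_exact₁ (shortExact_of_exact hf hfg hg) W
    (Abelian.Ext.mk₀ (ModuleCat.ofHom k)) (add_comm 1 0) (Subsingleton.elim _ _)
  obtain ⟨l, rfl⟩ := Abelian.Ext.addEquiv₀.symm.surjective y
  refine ⟨l.hom, fun x => ?_⟩
  have : Abelian.Ext.mk₀ (ModuleCat.ofHom f ≫ l) = Abelian.Ext.mk₀ (ModuleCat.ofHom k) := by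
    rw [← Abelian.Ext.mk₀_comp_mk₀]
    exact hy
  have := (Abelian.Ext.mk₀_bijective _ _).1 this
  simpa using LinearMap.congr_fun (congrArg ModuleCat.Hom.hom this) x

theorem exists_lift {f : X →ₗ[R] Y} {g : Y →ₗ[R] Z} (hf : Function.Injective f)
    (hfg : Function.Exact f g) (hg : Function.Surjective g) (h : ExtZero W X 1) (k : W →ₗ[R] Z) :
    ∃ l : W →ₗ[R] Y, ∀ x, g (l x) = k x := by
  obtain ⟨y, hy⟩ := Abelian.Ext.covariant_sequence_exact₃ W (shortExact_of_exact hf hfg hg)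
    (Abelian.Ext.mk₀ (ModuleCat.ofHom k)) (zero_add 1) (Subsingleton.elim _ _)
  obtain ⟨l, rfl⟩ := Abelian.Ext.addEquiv₀.symm.surjective y
  refine ⟨l.hom, fun x => ?_⟩
  have : Abelian.Ext.mk₀ (l ≫ ModuleCat.ofHom g) = Abelian.Ext.mk₀ (ModuleCat.ofHom k) := by
    rw [← Abelian.Ext.mk₀_comp_mk₀]
    exact hy
  have := (Abelian.Ext.mk₀_bijective _ _).1 this
  simpa using LinearMap.congr_fun (congrArg ModuleCat.Hom.hom this) x

theorem IsExtension.isRetract_of_extZero (h : IsExtension X Y Z) (h' : ExtZero Z X 1) :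
    IsRetract R Z Y := by
  obtain ⟨f, g, hf, hfg, hg⟩ := h
  obtain ⟨l, hl⟩ := exists_lift hf hfg hg h' LinearMap.id
  exact ⟨l, g, hl⟩

/-- The connecting map from homomorphisms `W → Z` to the first Ext of `W` and `X` is onto because
the middle Ext vanishes, and zero because every homomorphism lifts. -/
theorem extZero_one_of_lift {f : X →ₗ[R] Y} {g : Y →ₗ[R] Z} (hf : Function.Injective f)
    (hfg : Function.Exact f g) (hg : Function.Surjective g) (h : ExtZero W Y 1)
    (hlift : ∀ k : W →ₗ[R] Z, ∃ l : W →ₗ[R] Y, k = g ∘ₗ l) : ExtZero W X 1 := by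
  refine extZero_iff.2 fun x => ?_
  have hS := shortExact_of_exact hf hfg hg
  obtain ⟨y, rfl⟩ := Abelian.Ext.covariant_sequence_exact₁ W hS x (Subsingleton.elim _ _) (zero_add 1)
  obtain ⟨k, rfl⟩ := Abelian.Ext.addEquiv₀.symm.surjective y
  obtain ⟨l, hl⟩ := hlift k.hom
  have hk : k = ModuleCat.ofHom l ≫ ModuleCat.ofHom g := by ext1; exact hl
  subst hk
  change (Abelian.Ext.mk₀ (ModuleCat.ofHom l ≫ ModuleCat.ofHom g)).comp hS.extClass _ = 0
  rw [← Abelian.Ext.mk₀_comp_mk₀_assoc]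
  have : (Abelian.Ext.mk₀ (ModuleCat.ofHom g)).comp hS.extClass (zero_add 1) = 0 := hS.comp_extClass
  rw [this, Abelian.Ext.comp_zero]

theorem HasProjectiveDimensionLE.extZero {n : ℕ} (h : HasProjectiveDimensionLE X n) (k : ℕ)
    (hk : n < k) : ExtZero X Y k :=
  HasProjectiveDimensionLT.subsingleton X (n + 1) k hk Y

theorem HasInjectiveDimensionLE.extZero {n : ℕ} (h : HasInjectiveDimensionLE Y n) (k : ℕ)
    (hk : n < k) : ExtZero X Y k :=
  HasInjectiveDimensionLT.subsingleton Y (n + 1) k hk X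

theorem IsExtension.projDim_right (h : IsExtension X Y Z) {n : ℕ}
    (h1 : HasProjectiveDimensionLE X n) (h2 : HasProjectiveDimensionLE Y (n + 1)) :
    HasProjectiveDimensionLE Z (n + 1) := by
  obtain ⟨f, g, hf, hfg, hg⟩ := h
  exact (shortExact_of_exact hf hfg hg).hasProjectiveDimensionLT_X₃ (n + 1) h1 h2

theorem IsExtension.projDim_left (h : IsExtension X Y Z) {n : ℕ}
    (h1 : HasProjectiveDimensionLE Z (n + 1)) [Module.Projective R Y] :
    HasProjectiveDimensionLE X n := by
  obtain ⟨f, g, hf, hfg, hg⟩ := h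
  exact ((shortExact_of_exact hf hfg hg).hasProjectiveDimensionLT_X₃_iff n
    (projective_iff.2 ‹_›)).1 h1

theorem IsExtension.injDim_right (h : IsExtension X Y Z) {n : ℕ}
    (h1 : HasInjectiveDimensionLE X (n + 1)) [Module.Injective R Y] :
    HasInjectiveDimensionLE Z n := by
  obtain ⟨f, g, hf, hfg, hg⟩ := h
  exact ((shortExact_of_exact hf hfg hg).hasInjectiveDimensionLT_X₃_iff n
    (injective_iff.2 ‹_›)).2 h1

theorem projDim_zero_iff : HasProjectiveDimensionLE X 0 ↔ Module.Projective R X := by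
  rw [← projective_iff]
  exact (projective_iff_hasProjectiveDimensionLE_zero X).symm

theorem injDim_zero_iff : HasInjectiveDimensionLE X 0 ↔ Module.Injective R X := by
  rw [← injective_iff]
  exact injective_iff_hasInjectiveDimensionLT_one.symm

theorem HasProjectiveDimensionLE.mono {m n : ℕ} (h : HasProjectiveDimensionLE X m) (hmn : m ≤ n) :
    HasProjectiveDimensionLE X n :=
  hasProjectiveDimensionLT_of_ge X (m + 1) (n + 1) (by lia)

end ExtVanishing

/-! ### Modules orthogonal to a module that coresolves the ring. -/

section Tilting

variable {R : Type u} [Ring R]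

/-- There is an exact sequence `0 → X → T₀ → ⋯ → Tₙ → 0` with all `Tⱼ` in `add T`. -/
def IsCoresolvedBy (T : ModuleCat.{u} R) : ℕ → ModuleCat.{u} R → Prop
  | 0, X => AddOf R T X
  | n + 1, X => ∃ Y Z : ModuleCat.{u} R, IsExtension X Y Z ∧ AddOf R T Y ∧ IsCoresolvedBy T n Z

variable {T U V X : ModuleCat.{u} R}

theorem IsCoresolvedBy.extZero (hV : ∀ k, ExtZero T V (k + 1)) {n : ℕ}
    (h : IsCoresolvedBy T n X) (k : ℕ) : ExtZero X V (k + 1) := by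
  induction n generalizing X k with
  | zero => exact (hV k).addOf_left h
  | succ n ih =>
    obtain ⟨Y, Z, hXYZ, hY, hZ⟩ := h
    exact hXYZ.extZero_left' ((hV k).addOf_left hY) (ih hZ (k + 1))

/-- Since the first Ext of `Z` and `V` vanishes, `f` extends to the first term of the coresolution,
a summand of some `Tᵐ`. For `X` free of rank one this says that `T` generates `V`. -/
theorem IsCoresolvedBy.exists_mem_range (hV : ∀ k, ExtZero T V (k + 1)) {n : ℕ}
    (h : IsCoresolvedBy T n X) (f : X →ₗ[R] V) (x : X) :
    ∃ (m : ℕ) (g : (Fin m → T) →ₗ[R] V), f x ∈ LinearMap.range g := by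
  have key : ∀ (Y : ModuleCat.{u} R), AddOf R T Y → ∀ (l : Y →ₗ[R] V) (y : Y),
      ∃ (m : ℕ) (g : (Fin m → T) →ₗ[R] V), l y ∈ LinearMap.range g := by
    rintro Y ⟨m, s, p, hp⟩ l y
    exact ⟨m, l ∘ₗ p, s y, by simp [hp]⟩
  cases n with
  | zero => exact key X h f x
  | succ n =>
    obtain ⟨Y, Z, ⟨a, b, ha, hab, hb⟩, hY, hZ⟩ := h
    obtain ⟨l, hl⟩ := exists_extension ha hab hb (IsCoresolvedBy.extZero hV hZ 0) f
    rw [← hl]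
    exact key Y hY l _

variable (K : Type u) [Field K] [Algebra K R] [Module.Finite K R]

attribute [local instance] ModuleCat.moduleOfAlgebraModule
attribute [local instance] ModuleCat.isScalarTower_of_algebra_moduleCat

include K in
/-- Every homomorphism `T → V` factors through a suitable homomorphism `Tᵐ → V`. -/
theorem exists_right_approximation (T V : ModuleCat.{u} R) [Module.Finite R T] [Module.Finite R V] :
    ∃ (m : ℕ) (u : (Fin m → T) →ₗ[R] V), ∀ f : T →ₗ[R] V, ∃ k : T →ₗ[R] (Fin m → T),
      f = u ∘ₗ k := by
  have : Module.Finite K T := Module.Finite.trans R T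
  have : Module.Finite K V := Module.Finite.trans R V
  have : SMulCommClass R K V := IsScalarTower.to_smulCommClass'
  have : SMulCommClass R K T := IsScalarTower.to_smulCommClass'
  have : Module.Finite K (T →ₗ[R] V) :=
    Module.Finite.of_injective (LinearMap.restrictScalarsₗ K R T V K)
      (LinearMap.restrictScalars_injective K)
  obtain ⟨m, b, hb⟩ := Module.Finite.exists_fin (R := K) (M := T →ₗ[R] V)
  refine ⟨m, LinearMap.lsum R (fun _ => T) ℕ b, fun f => ?_⟩
  obtain ⟨c, rfl⟩ := (Submodule.mem_span_range_iff_exists_fun K).1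
    (hb.symm ▸ Submodule.mem_top : f ∈ Submodule.span K (Set.range b))
  refine ⟨LinearMap.pi fun j => c j • LinearMap.id, ?_⟩
  ext x
  simp

include K in
-- A right `add T`-approximation of `V` is onto because `T` generates `V`. Its kernel is again right
-- orthogonal to `T`: in degree one by the approximation property, in higher degrees by the long
-- exact sequence. The construction can therefore be iterated.
theorem exists_isExtension_of_isCoresolvedBy [Module.Finite R T] [Module.Finite R V]
    (hT : ∀ k, ExtZero T T (k + 1)) {G : ModuleCat.{u} R} (e : R ≃ₗ[R] G) {n : ℕ}
    (hG : IsCoresolvedBy T n G) (hV : ∀ k, ExtZero T V (k + 1)) :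
    ∃ (m : ℕ) (V' : ModuleCat.{u} R), IsExtension V' (ModuleCat.of R (Fin m → T)) V ∧
      Module.Finite R V' ∧ ∀ k, ExtZero T V' (k + 1) := by
  obtain ⟨m, u, hu⟩ := exists_right_approximation K T V
  have hsurj : Function.Surjective u := by
    intro v
    obtain ⟨m', g, hg⟩ := IsCoresolvedBy.exists_mem_range hV hG
      ((LinearMap.toSpanSingleton R V v) ∘ₗ e.symm.toLinearMap) (e 1)
    obtain ⟨t, ht⟩ := hg
    have hv : g t = v := by simpa using ht
    choose k hk using fun j : Fin m' => hu (g ∘ₗ LinearMap.single R (fun _ => T) j)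
    refine ⟨∑ j, k j (t j), ?_⟩
    rw [map_sum, ← hv]
    conv_rhs => rw [← Finset.univ_sum_single t, map_sum]
    exact Finset.sum_congr rfl fun j _ => (LinearMap.congr_fun (hk j) (t j)).symm
  have hR : IsNoetherianRing R := isNoetherian_of_tower K inferInstance
  have hex := isExtension_ker (X := ModuleCat.of R (Fin m → T)) (Y := V) (f := u) hsurj
  have hTm : ∀ k, ExtZero T (ModuleCat.of R (Fin m → T)) (k + 1) := fun k =>
    (hT k).addOf_right ⟨m, .refl⟩
  have hfin : Module.Finite R (ModuleCat.of R (Fin m → T)) :=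
    inferInstanceAs (Module.Finite R (Fin m → T))
  refine ⟨m, _, hex, hex.finite_left, fun k => ?_⟩
  cases k with
  | zero =>
    exact extZero_one_of_lift (X := ModuleCat.of R (LinearMap.ker u))
      (Y := ModuleCat.of R (Fin m → T)) (Submodule.subtype_injective _)
      (LinearMap.exact_subtype_ker_map u) hsurj (hTm 0) hu
  | succ k => exact hex.extZero_left (hV k) (hTm (k + 1))

include K in
/-- A module of finite projective dimension which has no extensions with a tilting module `T` in
either direction lies in `add T`. -/
theorem addOf_of_isCoresolvedBy [Module.Finite R T] [Module.Finite R U]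
    (hT : ∀ k, ExtZero T T (k + 1)) {G : ModuleCat.{u} R} (e : R ≃ₗ[R] G) {n : ℕ}
    (hG : IsCoresolvedBy T n G) (hTU : ∀ k, ExtZero T U (k + 1)) (hUT : ∀ k, ExtZero U T (k + 1))
    {d : ℕ} (hd : HasProjectiveDimensionLE U d) : AddOf R T U := by
  -- All positive Ext from `U` to the right orthogonal of `T` vanish: replacing `V` by the kernel of
  -- its approximation raises the degree by one, until it exceeds `d`. Vanishing in degree one on
  -- the kernel for `U` itself then splits the approximation.
  have key : ∀ (j : ℕ) (V : ModuleCat.{u} R), Module.Finite R V → (∀ k, ExtZero T V (k + 1)) →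
      ∀ k, d < k + 1 + j → ExtZero U V (k + 1) := by
    intro j
    induction j with
    | zero => intro V _ _ k hk; exact HasProjectiveDimensionLE.extZero hd _ hk
    | succ j ih =>
      intro V _ hV k hk
      obtain ⟨m, V', hex, hV', hTV'⟩ := exists_isExtension_of_isCoresolvedBy K hT e hG hV
      exact hex.extZero_right ((hUT k).addOf_right ⟨m, .refl⟩) (ih V' hV' hTV' (k + 1) (by lia))
  obtain ⟨m, V', hex, hV', hTV'⟩ := exists_isExtension_of_isCoresolvedBy K hT e hG hTU
  exact ⟨m, hex.isRetract_of_extZero (key d V' hV' hTV' 0 (by lia))⟩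

end Tilting

/-! ### Finite projective dimension is bounded by the self-injective dimension. -/

section Gorenstein

variable {R : Type u} [Ring R] [IsNoetherianRing R]

/-- After passing to syzygies, the kernel of a free cover is projective, and the vanishing of the
first Ext into it splits the cover. -/
theorem projDim_le_of_le_succ {n : ℕ} {Z : ModuleCat.{u} R} [Module.Finite R Z]
    (h : HasProjectiveDimensionLE Z (n + 1))
    (hZ : ∀ P : ModuleCat.{u} R, Module.Finite R P → Module.Projective R P → ExtZero Z P (n + 1)) :
    HasProjectiveDimensionLE Z n := by
  induction n generalizing Z with
  | zero =>
    obtain ⟨m, f, hf⟩ := Module.Finite.exists_fin' R Z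
    have hex := isExtension_ker (X := ModuleCat.of R (Fin m → R)) (Y := Z) (f := f) hf
    have : Module.Projective R (ModuleCat.of R (Fin m → R)) :=
      inferInstanceAs (Module.Projective R (Fin m → R))
    have : Module.Finite R (ModuleCat.of R (Fin m → R)) :=
      inferInstanceAs (Module.Finite R (Fin m → R))
    have hP := projDim_zero_iff.1 (hex.projDim_left h)
    exact projDim_zero_iff.2 (hex.isRetract_of_extZero (hZ _ hex.finite_left hP)).projective
  | succ n ih =>
    obtain ⟨m, f, hf⟩ := Module.Finite.exists_fin' R Z
    have hex := isExtension_ker (X := ModuleCat.of R (Fin m → R)) (Y := Z) (f := f) hf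
    have : Module.Projective R (ModuleCat.of R (Fin m → R)) :=
      inferInstanceAs (Module.Projective R (Fin m → R))
    have : Module.Finite R (ModuleCat.of R (Fin m → R)) :=
      inferInstanceAs (Module.Finite R (Fin m → R))
    have := hex.finite_left
    exact hex.projDim_right
      (ih (hex.projDim_left h) fun P hP hP' => hex.extZero_shift' (hZ P hP hP'))
      (HasProjectiveDimensionLE.mono (projDim_zero_iff.2 ‹_›) (Nat.zero_le _))

/-- A module of finite projective dimension has projective dimension at most the injective
dimension of the ring. -/
theorem projDim_le_of_injDim {r : ℕ} {G : ModuleCat.{u} R} (e : R ≃ₗ[R] G)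
    (hR : HasInjectiveDimensionLE G r) {Z : ModuleCat.{u} R} [Module.Finite R Z] {d : ℕ}
    (h : HasProjectiveDimensionLE Z d) : HasProjectiveDimensionLE Z r := by
  have hZ : ∀ k, r < k → ∀ P : ModuleCat.{u} R, Module.Finite R P → Module.Projective R P →
      ExtZero Z P k := by
    intro k hk P _ _
    obtain ⟨m, f, hf⟩ := Module.Finite.exists_fin' R P
    have hPG : AddOf R G P := AddOf.trans ⟨m, .of_surjective f hf⟩ (.of_isRetract (.of_equiv e))
    exact ExtZero.addOf_right (HasInjectiveDimensionLE.extZero hR k hk) hPG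
  -- `j` measures the excess over `r`, which is then removed one unit at a time.
  obtain ⟨j, hj⟩ : ∃ j, d ≤ r + j := ⟨d, by lia⟩
  have h' := HasProjectiveDimensionLE.mono h hj
  clear hj
  induction j with
  | zero => exact h'
  | succ j ih => exact ih (projDim_le_of_le_succ h' (hZ _ (by lia)))

end Gorenstein

/-! ### Dominant and codominant dimension through arbitrary projective-injective sequences. -/

section DominantDimension

variable {R : Type u} [Ring R]

/-- A finitely generated projective-injective module. -/
structure IsFiniteProjInj (R Q : Type u) [Ring R] [AddCommGroup Q] [Module R Q] : Prop where
  finite : Module.Finite R Q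
  projective : Module.Projective R Q
  injective : Module.Injective R Q

theorem IsFiniteProjInj.prod {Q Q' : Type u} [AddCommGroup Q] [Module R Q] [AddCommGroup Q']
    [Module R Q'] (h : IsFiniteProjInj R Q) (h' : IsFiniteProjInj R Q') :
    IsFiniteProjInj R (Q × Q') := by
  obtain ⟨_, _, _⟩ := h
  obtain ⟨_, _, _⟩ := h'
  exact ⟨inferInstance, inferInstance, inferInstance⟩

theorem IsFiniteProjInj.of_isRetract {Q Q' : Type u} [AddCommGroup Q] [Module R Q] [AddCommGroup Q']
    [Module R Q'] (h : IsFiniteProjInj R Q) (h' : IsRetract R Q' Q) : IsFiniteProjInj R Q' := by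
  obtain ⟨_, _, _⟩ := h
  exact ⟨h'.finite, h'.projective, h'.injective⟩

/-- There is an exact sequence `0 → M → Q₀ → ⋯ → Qₙ₋₁` with projective-injective terms. -/
def HasDominantDim : ℕ → ModuleCat.{u} R → Prop
  | 0, _ => True
  | n + 1, M => ∃ Q C : ModuleCat.{u} R, IsFiniteProjInj R Q ∧ IsExtension M Q C ∧ HasDominantDim n C

/-- There is an exact sequence `Qₙ₋₁ → ⋯ → Q₀ → M → 0` with projective-injective terms. -/
def HasCodominantDim : ℕ → ModuleCat.{u} R → Prop
  | 0, _ => True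
  | n + 1, M => ∃ Q C : ModuleCat.{u} R, IsFiniteProjInj R Q ∧ IsExtension C Q M ∧
      HasCodominantDim n C

variable {M N C Q X Y Z W : ModuleCat.{u} R}

theorem HasDominantDim.of_equiv {n : ℕ} (h : HasDominantDim n M) (e : N ≃ₗ[R] M) :
    HasDominantDim n N := by
  cases n with
  | zero => trivial
  | succ n =>
    obtain ⟨Q, C, hQ, hex, hC⟩ := h
    exact ⟨Q, C, hQ, hex.of_equiv_left e, hC⟩

theorem HasCodominantDim.of_equiv {n : ℕ} (h : HasCodominantDim n M) (e : M ≃ₗ[R] N) :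
    HasCodominantDim n N := by
  cases n with
  | zero => trivial
  | succ n =>
    obtain ⟨Q, C, hQ, hex, hC⟩ := h
    exact ⟨Q, C, hQ, hex.of_equiv_right e, hC⟩

theorem IsExtension.prod_left (h : IsExtension X Y Z) (W : ModuleCat.{u} R) :
    IsExtension (ModuleCat.of R (W × X)) (ModuleCat.of R (W × Y)) Z := by
  obtain ⟨f, g, hf, hfg, hg⟩ := h
  refine ⟨(LinearMap.id (M := W)).prodMap f, g ∘ₗ .snd R W Y, ?_, ?_, ?_⟩
  · exact Function.Injective.prodMap Function.injective_id hf
  · rintro ⟨w, y⟩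
    refine (hfg y).trans ⟨fun ⟨x, hx⟩ => ⟨(w, x), Prod.ext rfl hx⟩, fun ⟨x, hx⟩ => ⟨x.2, ?_⟩⟩
    exact congrArg Prod.snd hx
  · exact hg.comp LinearMap.snd_surjective

theorem IsExtension.prod_right (h : IsExtension X Y Z) (W : ModuleCat.{u} R) :
    IsExtension X (ModuleCat.of R (W × Y)) (ModuleCat.of R (W × Z)) := by
  obtain ⟨f, g, hf, hfg, hg⟩ := h
  refine ⟨.inr R W Y ∘ₗ f, (LinearMap.id (M := W)).prodMap g, ?_, ?_, ?_⟩
  · exact LinearMap.inr_injective.comp hf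
  · rintro ⟨w, y⟩
    constructor
    · intro h
      replace h : (w, g y) = ((0 : W), (0 : Z)) := h
      obtain ⟨x, hx⟩ := (hfg y).1 (congrArg Prod.snd h)
      have hw : w = 0 := congrArg Prod.fst h
      exact ⟨x, Prod.ext hw.symm hx⟩
    · rintro ⟨x, hx⟩
      obtain ⟨h1, h2⟩ := Prod.mk.inj (hx : ((0 : W), f x) = (w, y))
      rw [← h1, ← h2]
      exact Prod.ext rfl (hfg.apply_apply_eq_zero x)
  · exact Function.Surjective.prodMap Function.surjective_id hg

theorem HasDominantDim.prod {n : ℕ} (hQ : IsFiniteProjInj R Q) (h : HasDominantDim n M) :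
    HasDominantDim n (ModuleCat.of R (Q × M)) := by
  cases n with
  | zero => trivial
  | succ n =>
    obtain ⟨Q', C, hQ', hex, hC⟩ := h
    exact ⟨ModuleCat.of R (Q × Q'), C, hQ.prod hQ', hex.prod_left Q, hC⟩

theorem HasCodominantDim.prod {n : ℕ} (hQ : IsFiniteProjInj R Q) (h : HasCodominantDim n M) :
    HasCodominantDim n (ModuleCat.of R (Q × M)) := by
  cases n with
  | zero => trivial
  | succ n =>
    obtain ⟨Q', C, hQ', hex, hC⟩ := h
    exact ⟨ModuleCat.of R (Q × Q'), C, hQ.prod hQ', hex.prod_right Q, hC⟩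

/-- `X` embeds into the same `Q` as `Y`, and the new cokernel is an extension of `C` by the
injective module `Z`, hence isomorphic to `Z × C`. -/
theorem HasDominantDim.of_isExtension {n : ℕ} (h : HasDominantDim n Y) (hZ : IsFiniteProjInj R Z)
    (hex : IsExtension X Y Z) : HasDominantDim n X := by
  cases n with
  | zero => trivial
  | succ n =>
    obtain ⟨Q, C, hQ, ⟨f, g, hf, hfg, hg⟩, hC⟩ := h
    obtain ⟨a, b, ha, hab, hb⟩ := hex
    obtain ⟨_, _, _⟩ := hZ
    obtain ⟨t, ht⟩ := Module.projective_lifting_property b LinearMap.id hb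
    have ht' : ∀ z, b (t z) = z := fun z => LinearMap.congr_fun ht z
    let D := ModuleCat.of R (Q ⧸ LinearMap.range (f ∘ₗ a))
    refine ⟨Q, D, hQ, isExtension_coker (f := f ∘ₗ a) (hf.comp ha), ?_⟩
    let g' : D →ₗ[R] C := (LinearMap.range (f ∘ₗ a)).liftQ g (by
      rintro _ ⟨x, rfl⟩
      exact hfg.apply_apply_eq_zero (a x))
    let k : Z →ₗ[R] D := (LinearMap.range (f ∘ₗ a)).mkQ ∘ₗ f ∘ₗ t
    have hk : Function.Injective k := by
      refine (injective_iff_map_eq_zero _).2 fun z hz => ?_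
      obtain ⟨x, hx⟩ := (Submodule.Quotient.mk_eq_zero _).1 hz
      rw [← ht' z, ← hf hx, hab.apply_apply_eq_zero]
    have hkg : Function.Exact k g' := by
      intro d
      obtain ⟨y, rfl⟩ := Submodule.mkQ_surjective _ d
      constructor
      · intro hy
        obtain ⟨c, rfl⟩ := (hfg y).1 hy
        obtain ⟨x, hx⟩ := (hab (t (b c) - c)).1 (by rw [map_sub, ht', sub_self])
        refine ⟨b c, (Submodule.Quotient.eq _).2 ⟨x, ?_⟩⟩
        rw [LinearMap.comp_apply, hx]
        exact map_sub f _ _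
      · rintro ⟨z, hz⟩
        rw [← hz]
        exact hfg.apply_apply_eq_zero (t z)
    have hg' : Function.Surjective g' := fun c => by
      obtain ⟨y, rfl⟩ := hg c
      exact ⟨Submodule.Quotient.mk y, rfl⟩
    obtain ⟨e⟩ := exists_equiv_prod_of_injective hk hkg hg'
    exact (HasDominantDim.prod (Q := Z) ⟨‹_›, ‹_›, ‹_›⟩ hC).of_equiv e

theorem exists_factor {A B D : Type u} [AddCommGroup A] [Module R A] [AddCommGroup B] [Module R B]
    [AddCommGroup D] [Module R D] {g : A →ₗ[R] B} (hg : Function.Surjective g) (h : A →ₗ[R] D)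
    (hgh : ∀ x, g x = 0 → h x = 0) : ∃ k : B →ₗ[R] D, ∀ x, k (g x) = h x := by
  refine ⟨(LinearMap.ker g).liftQ h hgh ∘ₗ (g.quotKerEquivOfSurjective hg).symm.toLinearMap,
    fun x => ?_⟩
  have : (g.quotKerEquivOfSurjective hg).symm (g x) = (LinearMap.ker g).mkQ x := by
    rw [LinearEquiv.symm_apply_eq]
    rfl
  rw [LinearMap.comp_apply, LinearEquiv.coe_coe, this]
  exact Submodule.liftQ_apply _ _ _

/-- The first terms of an injective resolution with dominant dimension are summands of the terms of
the given one. -/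
theorem HasDominantDim.of_essential {n : ℕ} (h : HasDominantDim (n + 1) X) [Module.Injective R Y]
    {f : X →ₗ[R] Y} {g : Y →ₗ[R] Z} (hf : Function.Injective f) (hfg : Function.Exact f g)
    (hg : Function.Surjective g) (hess : IsEssential (LinearMap.range f)) :
    Module.Projective R Y ∧ HasDominantDim n Z := by
  obtain ⟨Q, C, hQ, ⟨a, b, ha, hab, hb⟩, hC⟩ := h
  have := hQ.projective
  have := hQ.injective
  -- Essentiality makes `s` injective, so `Y` splits off `Q` with complement `ker p`; the cokernels
  -- then form an exact sequence `0 → Z → C → ker p → 0`.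
  obtain ⟨s, hs⟩ := Module.Injective.out f hf a
  have hsi : Function.Injective s := hess.injective_of_comp (fun x y hxy => ha (by
    simpa [hs] using hxy))
  obtain ⟨p, hp⟩ := Module.Injective.out s hsi (LinearMap.id : Y →ₗ[R] Y)
  replace hp : ∀ y, p (s y) = y := hp
  refine ⟨IsRetract.projective ⟨s, p, hp⟩, ?_⟩
  obtain ⟨k, hk⟩ := exists_factor hg (b ∘ₗ s) fun y hy => by
    obtain ⟨x, rfl⟩ := (hfg y).1 hy
    rw [LinearMap.comp_apply, hs, hab.apply_apply_eq_zero]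
  obtain ⟨l, hl⟩ := exists_factor hb (LinearMap.codRestrict (LinearMap.ker p) (.id - s ∘ₗ p)
    (fun x => by simp [hp])) fun q hq => by
      obtain ⟨x, rfl⟩ := (hab q).1 hq
      ext
      simp [← hs, hp]
  have hl' : ∀ q, (l (b q) : Q) = q - s (p q) := fun q => by rw [hl]; simp
  have hQ' : IsFiniteProjInj R (LinearMap.ker p) := by
    obtain ⟨e, -⟩ := exists_equiv_prod_ker hp
    exact hQ.of_isRetract (IsRetract.snd.trans (.of_equiv e.symm))
  refine hC.of_isExtension (Z := ModuleCat.of R (LinearMap.ker p)) hQ' ⟨k, l, ?_, ?_, ?_⟩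
  · refine (injective_iff_map_eq_zero _).2 fun z hz => ?_
    obtain ⟨y, rfl⟩ := hg z
    rw [hk] at hz
    obtain ⟨x, hx⟩ := (hab _).1 hz
    rw [← hs] at hx
    rw [← hsi hx, hfg.apply_apply_eq_zero]
  · intro c
    obtain ⟨q, rfl⟩ := hb c
    constructor
    · intro hq
      have : q - s (p q) = 0 := by rw [← hl', hq]; rfl
      refine ⟨g (p q), ?_⟩
      rw [hk, LinearMap.comp_apply, ← sub_eq_zero.1 this]
    · rintro ⟨z, hz⟩
      obtain ⟨y, rfl⟩ := hg z
      rw [← hz, hk, LinearMap.comp_apply]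
      ext
      rw [hl', hp]
      simp
  · rintro ⟨q, hq⟩
    refine ⟨b q, Subtype.ext ?_⟩
    rw [hl', LinearMap.mem_ker.1 hq]
    simp

/-- The `n`-th cosyzygy is injective and embeds into a projective module, so it is projective; the
sequences then split back down to `M`. -/
theorem HasDominantDim.projective_of_injDim {n : ℕ} (h : HasDominantDim (n + 1) M)
    (hM : HasInjectiveDimensionLE M n) : Module.Projective R M := by
  induction n generalizing M with
  | zero =>
    obtain ⟨Q, C, hQ, ⟨f, g, hf, -⟩, -⟩ := h
    have := injDim_zero_iff.1 hM
    have := hQ.projective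
    exact (IsRetract.of_injective f hf).projective
  | succ n ih =>
    obtain ⟨Q, C, hQ, hex, hC⟩ := h
    have := hQ.injective
    have := ih hC (hex.injDim_right hM)
    obtain ⟨f, g, hf, hfg, hg⟩ := hex
    obtain ⟨e⟩ := exists_equiv_prod_of_projective hf hfg hg
    have := hQ.projective
    exact (IsRetract.fst.trans (.of_equiv e.symm)).projective

/-- By induction `C` is projective. It is also a quotient of an injective module, hence a summand of
it and injective, so `0 → C → Q → M → 0` splits. -/
theorem HasCodominantDim.projective_of_projDim {n : ℕ} (h : HasCodominantDim (n + 1) M)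
    (hM : HasProjectiveDimensionLE M n) : Module.Projective R M := by
  induction n generalizing M with
  | zero => exact projDim_zero_iff.1 hM
  | succ n ih =>
    obtain ⟨Q, C, hQ, hex, hC⟩ := h
    have := hQ.projective
    have hCp := ih hC (hex.projDim_left hM)
    obtain ⟨Q', C', hQ', ⟨f', g', -, -, hg'⟩, -⟩ := hC
    have := hQ'.injective
    have : Module.Injective R C := (IsRetract.of_surjective g' hg').injective
    obtain ⟨f, g, hf, hfg, hg⟩ := hex
    obtain ⟨e⟩ := exists_equiv_prod_of_injective hf hfg hg
    exact (IsRetract.snd.trans (.of_equiv e.symm)).projective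

/-- Modules of dominant dimension at least `n` and finite projective dimension. -/
theorem HasDominantDim.exists_cosyzygy {n : ℕ} (h : HasDominantDim n M) [Module.Finite R M] {d : ℕ}
    (hM : HasProjectiveDimensionLE M d) : ∃ Z : ModuleCat.{u} R, Module.Finite R Z ∧
      HasProjectiveDimensionLE Z (d + n) ∧
      ∀ s, n ≤ s → HasProjectiveDimensionLE Z s → HasProjectiveDimensionLE M (s - n) := by
  induction n generalizing M d with
  | zero => exact ⟨M, ‹_›, hM, fun s _ h => h⟩
  | succ n ih =>
    obtain ⟨Q, C, hQ, hex, hC⟩ := h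
    obtain ⟨_, _, _⟩ := hQ
    have := hex.finite_right
    obtain ⟨Z, hZ, hZd, hZs⟩ := ih hC (hex.projDim_right hM
      (HasProjectiveDimensionLE.mono (projDim_zero_iff.2 ‹_›) (Nat.zero_le _)))
    refine ⟨Z, hZ, by rwa [show d + (n + 1) = d + 1 + n by lia], fun s hs hs' => ?_⟩
    have hC' := hZs s (by lia) hs'
    obtain ⟨t, rfl⟩ : ∃ t, s = n + 1 + t := Nat.exists_eq_add_of_le hs
    rw [show n + 1 + t - n = t + 1 by lia] at hC'
    rw [show n + 1 + t - (n + 1) = t by lia]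
    exact hex.projDim_left hC'

/-- Each projective-injective term, being injective, raises the degree of Ext by one, until the
degree exceeds `d`. -/
theorem HasCodominantDim.extZero {n : ℕ} (h : HasCodominantDim n M) {d : ℕ}
    (hW : HasProjectiveDimensionLE W d) (k : ℕ) (hk : d ≤ n + k) : ExtZero W M (k + 1) := by
  induction n generalizing M k with
  | zero => exact HasProjectiveDimensionLE.extZero hW (k + 1) (by lia)
  | succ n ih =>
    obtain ⟨Q, C, hQ, hex, hC⟩ := h
    have := hQ.injective
    exact hex.extZero_shift (ih hC (k + 1) (by lia))

end DominantDimension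

/-! ### Existence and comparison of minimal resolutions. -/

section MinimalResolutions

variable {R : Type u} [Ring R]

/-- Every finitely generated module embeds into a finitely generated injective module. -/
def HasFiniteInjectives (R : Type u) [Ring R] : Prop :=
  ∀ M : ModuleCat.{u} R, Module.Finite R M → ∃ (E : ModuleCat.{u} R) (ι : M →ₗ[R] E),
    Module.Finite R E ∧ Module.Injective R E ∧ Function.Injective ι

theorem HasFiniteInjectives.finite_of_essential [IsNoetherianRing R] (h : HasFiniteInjectives R)
    {M E : ModuleCat.{u} R} [Module.Finite R M] {ι : M →ₗ[R] E} (hι : Function.Injective ι)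
    (hess : IsEssential (LinearMap.range ι)) : Module.Finite R E := by
  obtain ⟨E', ι', _, _, hι'⟩ := h M ‹_›
  obtain ⟨g, hg⟩ := Module.Injective.out ι hι ι'
  exact Module.Finite.of_injective g
    (hess.injective_of_comp fun x y hxy => hι' (by simpa [hg] using hxy))

theorem HasFiniteInjectives.exists_minimal_coresolution [IsNoetherianRing R] [IsArtinianRing R]
    (h : HasFiniteInjectives R) (M : ModuleCat.{u} R) [Module.Finite R M] :
    ∃ I : Coresolution M, I.IsMinimalInjective := by
  choose E ι hE hE' hι hess using fun N : {N : ModuleCat.{u} R // Module.Finite R N} =>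
    exists_injective_hull (h N.1 N.2)
  let next : {N : ModuleCat.{u} R // Module.Finite R N} → {N : ModuleCat.{u} R // Module.Finite R N} :=
    fun N => ⟨ModuleCat.of R (E N ⧸ LinearMap.range (ι N)),
      have := hE N; inferInstanceAs (Module.Finite R (E N ⧸ LinearMap.range (ι N)))⟩
  let Y : ℕ → {N : ModuleCat.{u} R // Module.Finite R N} := fun n =>
    Nat.rec ⟨M, ‹_›⟩ (fun _ N => next N) n
  let q : ∀ n, E (Y n) →ₗ[R] (Y (n + 1)).1 := fun n => (LinearMap.range (ι (Y n))).mkQ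
  have hq : ∀ n, Function.Surjective (q n) := fun n => Submodule.mkQ_surjective _
  have hιq : ∀ n, Function.Exact (ι (Y n)) (q n) := fun n => LinearMap.exact_map_mkQ_range _
  have hrange : ∀ n, LinearMap.range (ι (Y (n + 1)) ∘ₗ q n) = LinearMap.range (ι (Y (n + 1))) :=
    fun n => LinearMap.range_comp_of_range_eq_top _ (LinearMap.range_eq_top.2 (hq n))
  have hker : ∀ n x, (ι (Y (n + 1)) ∘ₗ q n) x = 0 ↔ x ∈ Set.range (ι (Y n)) := fun n x => by
    rw [LinearMap.comp_apply, map_eq_zero_iff _ (hι _)]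
    exact hιq n x
  refine ⟨⟨fun n => E (Y n), ι (Y 0), fun n => ι (Y (n + 1)) ∘ₗ q n, hι _, hker 0, fun n x => ?_⟩,
    fun n => injective_iff.2 (hE' _), hess _, fun n => ?_⟩
  · rw [hker (n + 1) x, ← LinearMap.coe_range, ← hrange n]
    rfl
  · rw [hrange n]
    exact hess _

theorem exists_minimal_resolution [IsNoetherianRing R] [IsArtinianRing R] (M : ModuleCat.{u} R)
    [Module.Finite R M] : ∃ P : Resolution M, P.IsMinimalProjective := by
  choose P π hP hP' hπ hsup using fun N : {N : ModuleCat.{u} R // Module.Finite R N} =>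
    have := N.2; exists_projective_cover (R := R) N.1
  let next : {N : ModuleCat.{u} R // Module.Finite R N} → {N : ModuleCat.{u} R // Module.Finite R N} :=
    fun N => ⟨ModuleCat.of R (LinearMap.ker (π N)),
      have := hP N; inferInstanceAs (Module.Finite R (LinearMap.ker (π N)))⟩
  let Y : ℕ → {N : ModuleCat.{u} R // Module.Finite R N} := fun n =>
    Nat.rec ⟨M, ‹_›⟩ (fun _ N => next N) n
  let i : ∀ n, (Y (n + 1)).1 →ₗ[R] P (Y n) := fun n => (LinearMap.ker (π (Y n))).subtype
  have hi : ∀ n, Function.Injective (i n) := fun n => Submodule.subtype_injective _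
  have hiπ : ∀ n, Function.Exact (i n) (π (Y n)) := fun n => LinearMap.exact_subtype_ker_map _
  have hrange : ∀ n, Set.range (i n ∘ₗ π (Y (n + 1))) = Set.range (i n) := fun n => by
    rw [← LinearMap.coe_range, ← LinearMap.coe_range,
      LinearMap.range_comp_of_range_eq_top _ (LinearMap.range_eq_top.2 (hπ _))]
  have hker : ∀ n, LinearMap.ker (i n ∘ₗ π (Y (n + 1))) = LinearMap.ker (π (Y (n + 1))) := fun n =>
    LinearMap.ker_comp_of_ker_eq_bot _ (LinearMap.ker_eq_bot.2 (hi n))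
  refine ⟨⟨fun n => P (Y n), π (Y 0), fun n => i n ∘ₗ π (Y (n + 1)), hπ _, fun x => ?_,
    fun n x => ?_⟩, fun n => projective_iff.2 (hP' _), hsup _, fun n => ?_⟩
  · rw [hrange 0]
    exact hiπ 0 x
  · rw [hrange (n + 1), ← hiπ (n + 1) x]
    exact (map_eq_zero_iff _ (hi n))
  · rw [hker n]
    exact hsup _

namespace Coresolution

variable {M : ModuleCat.{u} R} (I : Coresolution M)

/-- The `n`-th cosyzygy of a coresolution. -/
abbrev cosyzygy (n : ℕ) : ModuleCat.{u} R := ModuleCat.of R (LinearMap.ker (I.d n))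

theorem nonempty_equiv_cosyzygy_zero : Nonempty (M ≃ₗ[R] I.cosyzygy 0) := by
  refine ⟨LinearEquiv.ofBijective (LinearMap.codRestrict _ I.ι fun x =>
    I.exact_zero.apply_apply_eq_zero x) ⟨fun x y hxy => I.injective_ι (congrArg Subtype.val hxy), ?_⟩⟩
  rintro ⟨x, hx⟩
  obtain ⟨m, rfl⟩ := (I.exact_zero x).1 hx
  exact ⟨m, rfl⟩

/-- The map from the `n`-th term onto the next cosyzygy. -/
abbrev toCosyzygy (n : ℕ) : I.X n →ₗ[R] I.cosyzygy (n + 1) :=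
  LinearMap.codRestrict _ (I.d n) fun x => (I.exact_succ n).apply_apply_eq_zero x

theorem toCosyzygy_surjective (n : ℕ) : Function.Surjective (I.toCosyzygy n) := by
  rintro ⟨x, hx⟩
  obtain ⟨m, rfl⟩ := (I.exact_succ n x).1 hx
  exact ⟨m, rfl⟩

theorem ker_toCosyzygy (n : ℕ) : LinearMap.ker (I.toCosyzygy n) = LinearMap.ker (I.d n) :=
  LinearMap.ker_codRestrict _ _ _

theorem exact_toCosyzygy (n : ℕ) :
    Function.Exact (LinearMap.ker (I.d n)).subtype (I.toCosyzygy n) := by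
  rw [LinearMap.exact_iff, ker_toCosyzygy, Submodule.range_subtype]

theorem isExtension_cosyzygy (n : ℕ) : IsExtension (I.cosyzygy n) (I.X n) (I.cosyzygy (n + 1)) :=
  ⟨(LinearMap.ker (I.d n)).subtype, I.toCosyzygy n, Submodule.subtype_injective _,
    I.exact_toCosyzygy n, I.toCosyzygy_surjective n⟩

variable {I}

theorem IsMinimalInjective.module_injective (hI : I.IsMinimalInjective) (n : ℕ) :
    Module.Injective R (I.X n) := injective_iff.1 (hI.injective n)

theorem IsMinimalInjective.essential_cosyzygy (hI : I.IsMinimalInjective) (n : ℕ) :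
    IsEssential (LinearMap.range (LinearMap.ker (I.d n)).subtype) := by
  rw [Submodule.range_subtype]
  cases n with
  | zero => rw [LinearMap.exact_iff.1 I.exact_zero]; exact hI.essential_zero
  | succ n => rw [LinearMap.exact_iff.1 (I.exact_succ n)]; exact hI.essential_succ n

theorem IsMinimalInjective.finite [IsNoetherianRing R] (hR : HasFiniteInjectives R)
    [Module.Finite R M] (hI : I.IsMinimalInjective) (n : ℕ) :
    Module.Finite R (I.cosyzygy n) ∧ Module.Finite R (I.X n) := by
  have key : ∀ n, Module.Finite R (I.cosyzygy n) → Module.Finite R (I.X n) := fun n _ =>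
    hR.finite_of_essential (M := I.cosyzygy n) (ι := (LinearMap.ker (I.d n)).subtype)
      (Submodule.subtype_injective _) (hI.essential_cosyzygy n)
  have h : Module.Finite R (I.cosyzygy n) := by
    induction n with
    | zero =>
      obtain ⟨e⟩ := I.nonempty_equiv_cosyzygy_zero
      exact Module.Finite.equiv e
    | succ n ih =>
      have := key n ih
      exact (I.isExtension_cosyzygy n).finite_right
  exact ⟨h, key n h⟩

theorem IsMinimalInjective.projective_of_hasDominantDim (hI : I.IsMinimalInjective) {n j : ℕ}
    (h : HasDominantDim n (I.cosyzygy j)) (k : ℕ) (hk : k < n) :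
    Module.Projective R (I.X (j + k)) := by
  induction n generalizing j k with
  | zero => lia
  | succ n ih =>
    have := hI.module_injective j
    have h' := h.of_essential (Submodule.subtype_injective _) (I.exact_toCosyzygy j)
      (I.toCosyzygy_surjective j) (hI.essential_cosyzygy j)
    cases k with
    | zero => exact h'.1
    | succ k =>
      rw [show j + (k + 1) = j + 1 + k by lia]
      exact ih h'.2 k (by lia)

theorem IsMinimalInjective.hasDominantDim [IsNoetherianRing R] (hR : HasFiniteInjectives R)
    [Module.Finite R M] (hI : I.IsMinimalInjective) {n j : ℕ}
    (h : ∀ k < n, Module.Projective R (I.X (j + k))) : HasDominantDim n (I.cosyzygy j) := by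
  induction n generalizing j with
  | zero => trivial
  | succ n ih =>
    refine ⟨_, _, ⟨(hI.finite hR j).2, h 0 n.succ_pos, hI.module_injective j⟩,
      I.isExtension_cosyzygy j, ih fun k hk => ?_⟩
    rw [show j + 1 + k = j + (k + 1) by lia]
    exact h (k + 1) (by lia)

end Coresolution

/-- Replaces minimal resolutions by arbitrary projective-injective coresolutions, which are stable
under sums with projective-injectives and under duality. -/
theorem le_domDim_iff [IsNoetherianRing R] [IsArtinianRing R] (hR : HasFiniteInjectives R)
    (M : ModuleCat.{u} R) [Module.Finite R M] (n : ℕ) :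
    (n : ℕ∞) ≤ domDim M ↔ HasDominantDim n M := by
  constructor
  · intro h
    obtain ⟨m, hnm, I, hI, hm⟩ : ∃ m, n ≤ m ∧ ∃ I : Coresolution M, I.IsMinimalInjective ∧
        ∀ j < m, Projective (I.X j) := by
      cases n with
      | zero =>
        obtain ⟨I, hI⟩ := hR.exists_minimal_coresolution M
        exact ⟨0, le_rfl, I, hI, by simp⟩
      | succ n =>
        by_contra! hc
        -- The supremum need not be attained a priori; if no minimal resolution had `n + 1`
        -- projective initial terms, it would be at most `n`.
        have : domDim M ≤ n := by
          refine sSup_le ?_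
          rintro _ ⟨m, rfl, I, hI, hm⟩
          by_contra! hlt
          obtain ⟨j, hj, hj'⟩ := hc m (by exact_mod_cast hlt) I hI
          exact hj' (hm j hj)
        have := h.trans this
        norm_cast at this
        lia
    obtain ⟨e⟩ := I.nonempty_equiv_cosyzygy_zero
    refine HasDominantDim.of_equiv (hI.hasDominantDim hR fun k hk => ?_) e
    rw [zero_add]
    exact projective_iff.1 (hm k (by lia))
  · intro h
    obtain ⟨I, hI⟩ := hR.exists_minimal_coresolution M
    obtain ⟨e⟩ := I.nonempty_equiv_cosyzygy_zero
    refine le_sSup ⟨n, rfl, I, hI, fun j hj => projective_iff.2 ?_⟩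
    have := hI.projective_of_hasDominantDim (h.of_equiv e.symm) j hj
    rwa [zero_add] at this

theorem isSyzygy_zero [IsNoetherianRing R] [IsArtinianRing R] (M : ModuleCat.{u} R)
    [Module.Finite R M] : IsSyzygy 0 M M := by
  obtain ⟨P, hP⟩ := exists_minimal_resolution M
  refine ⟨P, hP, ⟨?_⟩⟩
  exact (P.π.quotKerEquivOfSurjective P.surjective_π).symm.trans
    (Submodule.quotEquivOfEq _ _ (LinearMap.exact_iff.1 P.exact_zero))

/-- The sequence of modules `P, X 0, X 1, …`. -/
def consObj (P : ModuleCat.{u} R) (X : ℕ → ModuleCat.{u} R) : ℕ → ModuleCat.{u} R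
  | 0 => P
  | n + 1 => X n

/-- The differentials of the sequence `P, X 0, X 1, …`. -/
def consMap (P : ModuleCat.{u} R) (X : ℕ → ModuleCat.{u} R) (d : ∀ n, X (n + 1) →ₗ[R] X n)
    (f : X 0 →ₗ[R] P) : ∀ n, consObj P X (n + 1) →ₗ[R] consObj P X n
  | 0 => f
  | n + 1 => d n

theorem IsSyzygy.succ {n : ℕ} {L P M N : ModuleCat.{u} R} [Module.Projective R P] {f : L →ₗ[R] P}
    {g : P →ₗ[R] M} (hf : Function.Injective f) (hfg : Function.Exact f g)
    (hg : Function.Surjective g) (hsup : IsSuperfluous (LinearMap.ker g)) (h : IsSyzygy n L N) :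
    IsSyzygy (n + 1) M N := by
  obtain ⟨Q, hQ, hN⟩ := h
  refine ⟨⟨consObj P Q.X, g, consMap P Q.X Q.d (f ∘ₗ Q.π), hg, fun x => ?_, fun n x => ?_⟩, ⟨fun n => ?_, hsup, fun n => ?_⟩, hN⟩
  · exact (hfg x).trans (SetLike.ext_iff.1 (LinearMap.range_comp_of_range_eq_top f
      (LinearMap.range_eq_top.2 Q.surjective_π)) x).symm
  · cases n with
    | zero => exact (map_eq_zero_iff f hf).trans (Q.exact_zero x)
    | succ n => exact Q.exact_succ n x
  · cases n with
    | zero => exact projective_iff.2 ‹_›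
    | succ n => exact hQ.projective n
  · cases n with
    | zero =>
      have : LinearMap.ker (f ∘ₗ Q.π) = LinearMap.ker Q.π :=
        LinearMap.ker_comp_of_ker_eq_bot _ (LinearMap.ker_eq_bot.2 hf)
      exact this.symm ▸ hQ.superfluous_zero
    | succ n => exact hQ.superfluous_succ n

end MinimalResolutions

/-! ### The duality over anti-isomorphic rings, set up so that the double dual returns to the
original ring. -/

section TwistedDual

variable {K : Type u} [Field K] {R S : Type u} [Ring R] [Algebra K R] [Ring S] [Algebra K S]

attribute [local instance] ModuleCat.moduleOfAlgebraModule
attribute [local instance] ModuleCat.isScalarTower_of_algebra_moduleCat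

/-- The dual of an `R`-module as a module over a ring anti-isomorphic to `R`. -/
noncomputable def twistedDual (σ : S ≃ₐ[K] Rᵐᵒᵖ) (M : ModuleCat.{u} R) : ModuleCat.{u} S :=
  letI := Module.compHom (dual K M) (σ : S →+* Rᵐᵒᵖ)
  ModuleCat.of S (dual K M)

variable (σ : S ≃ₐ[K] Rᵐᵒᵖ) {M N L : ModuleCat.{u} R}

/-- Elements of the dual as linear forms. -/
def twistedDual.form (f : twistedDual σ M) : Module.Dual K M := f

/-- Linear forms as elements of the dual. -/
def twistedDual.ofForm (f : Module.Dual K M) : twistedDual σ M := f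

variable {σ}

theorem twistedDual.ext {f g : twistedDual σ M} (h : ∀ x, form σ f x = form σ g x) : f = g :=
  LinearMap.ext (f := form σ f) (g := form σ g) h

@[simp] theorem twistedDual.form_ofForm (f : Module.Dual K M) : form σ (ofForm σ f) = f := rfl

@[simp] theorem twistedDual.form_add (f g : twistedDual σ M) : form σ (f + g) = form σ f + form σ g :=
  rfl

@[simp] theorem twistedDual.form_zero : form σ (0 : twistedDual σ M) = 0 := rfl

@[simp] theorem twistedDual.form_smul (s : S) (f : twistedDual σ M) (x : M) :
    form σ (s • f) x = form σ f ((σ s).unop • x) := rfl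

theorem twistedDual.form_smul_field (k : K) (f : twistedDual σ M) :
    form σ (k • f) = k • form σ f := by
  ext x
  change form σ (algebraMap K S k • f) x = _
  rw [twistedDual.form_smul, AlgEquiv.commutes]
  exact (form σ f).map_smul k x

/-- The dual of a module with its two `K`-structures. -/
noncomputable def twistedDual.formEquiv : twistedDual σ M ≃ₗ[K] Module.Dual K M where
  toFun := form σ
  invFun := ofForm σ
  map_add' _ _ := rfl
  map_smul' := form_smul_field
  left_inv _ := rfl
  right_inv _ := rfl

theorem twistedDual.finite [Module.Finite K R] [Module.Finite R M] : Module.Finite S (twistedDual σ M) := by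
  have : Module.Finite K M := Module.Finite.trans R M
  have : Module.Finite K (twistedDual σ M) := Module.Finite.equiv twistedDual.formEquiv.symm
  exact Module.Finite.of_restrictScalars_finite K S _

open twistedDual

variable (σ) in
/-- The transpose of a homomorphism. -/
noncomputable def twistedDualMap (f : M →ₗ[R] N) : twistedDual σ N →ₗ[S] twistedDual σ M where
  toFun φ := ofForm σ (form σ φ ∘ₗ f.restrictScalars K)
  map_add' _ _ := rfl
  map_smul' s φ := twistedDual.ext fun x => by simp

@[simp] theorem form_twistedDualMap (f : M →ₗ[R] N) (φ : twistedDual σ N) (x : M) :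
    form σ (twistedDualMap σ f φ) x = form σ φ (f x) := rfl

theorem twistedDualMap_surjective {f : M →ₗ[R] N} (hf : Function.Injective f) :
    Function.Surjective (twistedDualMap σ f) := fun φ => by
  obtain ⟨ψ, hψ⟩ := LinearMap.dualMap_surjective_of_injective (f := f.restrictScalars K) hf (form σ φ)
  exact ⟨ofForm σ ψ, hψ⟩

theorem IsRetract.twistedDual (h : IsRetract R M N) :
    IsRetract S (twistedDual σ M) (twistedDual σ N) := by
  obtain ⟨s, p, hp⟩ := h
  exact ⟨twistedDualMap σ p, twistedDualMap σ s, fun φ => twistedDual.ext fun x => by simp [hp]⟩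

theorem IsExtension.twistedDual (h : IsExtension M N L) :
    IsExtension (twistedDual σ L) (twistedDual σ N) (twistedDual σ M) := by
  obtain ⟨f, g, hf, hfg, hg⟩ := h
  refine ⟨twistedDualMap σ g, twistedDualMap σ f, fun φ ψ h => twistedDual.ext fun x => ?_, fun φ => ?_,
    twistedDualMap_surjective hf⟩
  · obtain ⟨y, rfl⟩ := hg x
    exact LinearMap.congr_fun (congrArg (form σ) h) y
  · constructor
    · intro hφ
      obtain ⟨ψ, hψ⟩ := exists_factor (R := K) (g := g.restrictScalars K) hg (form σ φ) fun x hx => by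
        obtain ⟨y, rfl⟩ := (hfg x).1 hx
        exact LinearMap.congr_fun (congrArg (form σ) hφ) y
      exact ⟨ofForm σ ψ, LinearMap.ext (f := (form σ (twistedDualMap σ g (ofForm σ ψ)))) hψ⟩
    · rintro ⟨ψ, rfl⟩
      refine twistedDual.ext fun x => ?_
      simp [hfg.apply_apply_eq_zero]

variable {τ : R ≃ₐ[K] Sᵐᵒᵖ}

/-- The bijection `Hom(X, D(M)) ≅ Hom(M, D(X))`. -/
noncomputable def twistedTranspose (h : ∀ r, (σ (τ r).unop).unop = r) {X : ModuleCat.{u} S}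
    (g : X →ₗ[S] twistedDual σ M) : M →ₗ[R] twistedDual τ X where
  toFun m := ofForm τ
    { toFun := fun x => form σ (g x) m
      map_add' := fun x y => by simp
      map_smul' := fun k x => by
        rw [← algebraMap_smul S k x, map_smul, form_smul, AlgEquiv.commutes]
        exact (form σ (g x)).map_smul k m }
  map_add' a b := twistedDual.ext fun x => (form σ (g x)).map_add a b
  map_smul' r m := twistedDual.ext fun x => by
    change form σ (g x) (r • m) = form σ (g ((τ r).unop • x)) m
    rw [LinearMap.map_smul g, form_smul, h]

@[simp] theorem form_twistedTranspose (h : ∀ r, (σ (τ r).unop).unop = r) {X : ModuleCat.{u} S}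
    (g : X →ₗ[S] twistedDual σ M) (m : M) (x : X) :
    form τ (twistedTranspose h g m) x = form σ (g x) m := rfl

/-- Transposition turns an extension problem into the dual into a lifting problem from the
projective module `M`. -/
theorem injective_twistedDual (h : ∀ r, (σ (τ r).unop).unop = r)
    (h' : ∀ s, (τ (σ s).unop).unop = s) [Module.Projective R M] :
    Module.Injective S (twistedDual σ M) := by
  have key : ∀ (X Y : ModuleCat.{u} S) (f : X →ₗ[S] Y), Function.Injective f →
      ∀ g : X →ₗ[S] twistedDual σ M, ∃ l : Y →ₗ[S] twistedDual σ M, ∀ x, l (f x) = g x := by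
    intro X Y f hf g
    obtain ⟨k, hk⟩ := Module.projective_lifting_property (twistedDualMap τ f)
      (twistedTranspose h g) (twistedDualMap_surjective hf)
    refine ⟨twistedTranspose h' k, fun x => twistedDual.ext fun m => ?_⟩
    exact LinearMap.congr_fun (congrArg (form τ) (LinearMap.congr_fun hk m)) x
  exact ⟨fun X Y _ _ _ _ f hf g => key (ModuleCat.of S X) (ModuleCat.of S Y) f hf g⟩

theorem exists_equiv_twistedDual (h : ∀ r, (σ (τ r).unop).unop = r) [Module.Finite K R]
    [Module.Finite R M] : Nonempty (M ≃ₗ[R] twistedDual τ (twistedDual σ M)) := by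
  have : Module.Finite K M := Module.Finite.trans R M
  refine ⟨LinearEquiv.ofBijective (twistedTranspose h LinearMap.id) ⟨?_, fun φ => ?_⟩⟩
  · refine (injective_iff_map_eq_zero _).2 fun m hm => ?_
    refine (Module.forall_dual_apply_eq_zero_iff K m).1 fun f => ?_
    exact LinearMap.congr_fun (congrArg (form τ) hm) (ofForm σ f)
  · obtain ⟨m, hm⟩ := (Module.evalEquiv K M).surjective (form τ φ ∘ₗ formEquiv.symm.toLinearMap)
    exact ⟨m, twistedDual.ext fun f => LinearMap.congr_fun hm (form σ f)⟩

/-- Dualizing a free cover of the dual embeds `M` into the dual of a free module. The embedding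
splits since `M` is injective, and dualizing again makes the dual of `M` a summand of a free module.
-/
theorem projective_twistedDual (h : ∀ r, (σ (τ r).unop).unop = r)
    (h' : ∀ s, (τ (σ s).unop).unop = s) [Module.Finite K R] [Module.Finite K S] [Module.Finite R M]
    [Module.Injective R M] : Module.Projective S (twistedDual σ M) := by
  have := twistedDual.finite (σ := σ) (M := M)
  obtain ⟨n, f, hf⟩ := Module.Finite.exists_fin' S (twistedDual σ M)
  obtain ⟨k, l, hk, -⟩ := (isExtension_ker (X := ModuleCat.of S (Fin n → S)) hf).twistedDual (σ := τ)
  obtain ⟨e⟩ := exists_equiv_twistedDual (M := M) h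
  have h1 : IsRetract R M (twistedDual τ (ModuleCat.of S (Fin n → S))) :=
    .of_injective (k ∘ₗ e.toLinearMap) (hk.comp e.injective)
  obtain ⟨e'⟩ := exists_equiv_twistedDual (M := ModuleCat.of S (Fin n → S)) h'
  have : Module.Finite S (ModuleCat.of S (Fin n → S)) := inferInstanceAs (Module.Finite S (Fin n → S))
  exact ((h1.twistedDual (σ := σ)).trans (.of_equiv e'.symm)).projective

end TwistedDual

/-! ### Transport of homological conditions along the duality. -/

section DualityConsequences

variable {K : Type u} [Field K] {R S : Type u} [Ring R] [Algebra K R] [Ring S] [Algebra K S]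
  {σ : S ≃ₐ[K] Rᵐᵒᵖ} {τ : R ≃ₐ[K] Sᵐᵒᵖ} {M : ModuleCat.{u} R} {X : ModuleCat.{u} S}

open twistedDual

theorem IsFiniteProjInj.twistedDual (h : ∀ r, (σ (τ r).unop).unop = r)
    (h' : ∀ s, (τ (σ s).unop).unop = s) [Module.Finite K R] [Module.Finite K S]
    (hM : IsFiniteProjInj R M) : IsFiniteProjInj S (twistedDual σ M) := by
  obtain ⟨_, _, _⟩ := hM
  exact ⟨twistedDual.finite, projective_twistedDual h h', injective_twistedDual h h'⟩

theorem HasCodominantDim.twistedDual (h : ∀ r, (σ (τ r).unop).unop = r)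
    (h' : ∀ s, (τ (σ s).unop).unop = s) [Module.Finite K R] [Module.Finite K S] {n : ℕ}
    (hM : HasCodominantDim n M) : HasDominantDim n (twistedDual σ M) := by
  induction n generalizing M with
  | zero => trivial
  | succ n ih =>
    obtain ⟨Q, C, hQ, hex, hC⟩ := hM
    exact ⟨_, _, hQ.twistedDual h h', hex.twistedDual, ih hC⟩

theorem HasDominantDim.twistedDual (h : ∀ r, (σ (τ r).unop).unop = r)
    (h' : ∀ s, (τ (σ s).unop).unop = s) [Module.Finite K R] [Module.Finite K S] {n : ℕ}
    (hM : HasDominantDim n M) : HasCodominantDim n (twistedDual σ M) := by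
  induction n generalizing M with
  | zero => trivial
  | succ n ih =>
    obtain ⟨Q, C, hQ, hex, hC⟩ := hM
    exact ⟨_, _, hQ.twistedDual h h', hex.twistedDual, ih hC⟩

variable (K R) in
include K in
-- Dualize a free cover of the dual of `M`.
theorem hasFiniteInjectives [Module.Finite K R] : HasFiniteInjectives R := by
  intro M _
  have hS : Module.Finite K Rᵐᵒᵖ := inferInstance
  let σ : Rᵐᵒᵖ ≃ₐ[K] Rᵐᵒᵖ := AlgEquiv.refl
  let τ : R ≃ₐ[K] Rᵐᵒᵖᵐᵒᵖ := AlgEquiv.opOp K R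
  have := twistedDual.finite (σ := σ) (M := M)
  obtain ⟨n, f, hf⟩ := Module.Finite.exists_fin' Rᵐᵒᵖ (AuslanderGorenstein.twistedDual σ M)
  obtain ⟨k, l, hk, -⟩ :=
    (isExtension_ker (X := ModuleCat.of Rᵐᵒᵖ (Fin n → Rᵐᵒᵖ)) hf).twistedDual (σ := τ)
  obtain ⟨e⟩ := exists_equiv_twistedDual (M := M) (σ := σ) (τ := τ) fun _ => rfl
  have : Module.Finite Rᵐᵒᵖ (ModuleCat.of Rᵐᵒᵖ (Fin n → Rᵐᵒᵖ)) :=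
    inferInstanceAs (Module.Finite Rᵐᵒᵖ (Fin n → Rᵐᵒᵖ))
  have : Module.Projective Rᵐᵒᵖ (ModuleCat.of Rᵐᵒᵖ (Fin n → Rᵐᵒᵖ)) :=
    inferInstanceAs (Module.Projective Rᵐᵒᵖ (Fin n → Rᵐᵒᵖ))
  exact ⟨_, k ∘ₗ e.toLinearMap, twistedDual.finite,
    injective_twistedDual (σ := τ) (τ := σ) (fun _ => rfl) fun _ => rfl, hk.comp e.injective⟩

theorem projDim_twistedDual (h : ∀ r, (σ (τ r).unop).unop = r)
    (h' : ∀ s, (τ (σ s).unop).unop = s) [Module.Finite K R] [Module.Finite K S] [Module.Finite R M]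
    {n : ℕ} (hM : HasInjectiveDimensionLE M n) : HasProjectiveDimensionLE (twistedDual σ M) n := by
  induction n generalizing M with
  | zero =>
    have := injDim_zero_iff.1 hM
    exact projDim_zero_iff.2 (projective_twistedDual h h')
  | succ n ih =>
    obtain ⟨E, ι, _, _, hι⟩ := hasFiniteInjectives K R M ‹_›
    have hex := isExtension_coker hι
    have := hex.finite_right
    exact hex.twistedDual.projDim_right (ih (hex.injDim_right hM))
      (HasProjectiveDimensionLE.mono (projDim_zero_iff.2 (projective_twistedDual h h'))
        (Nat.zero_le _))

variable (K) in
theorem le_codomDim_iff [Module.Finite K R] [Module.Finite R M] (n : ℕ) :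
    (n : ℕ∞) ≤ codomDim K M ↔ HasCodominantDim n M := by
  let σ : Rᵐᵒᵖ ≃ₐ[K] Rᵐᵒᵖ := AlgEquiv.refl
  let τ : R ≃ₐ[K] Rᵐᵒᵖᵐᵒᵖ := AlgEquiv.opOp K R
  have : Module.Finite K Rᵐᵒᵖ := inferInstance
  have : IsNoetherianRing Rᵐᵒᵖ := isNoetherian_of_tower K inferInstance
  have : IsArtinianRing Rᵐᵒᵖ := isArtinian_of_tower K inferInstance
  have : Module.Finite Rᵐᵒᵖ (dual K M) := twistedDual.finite (σ := σ) (M := M)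
  rw [codomDim, le_domDim_iff (hasFiniteInjectives K Rᵐᵒᵖ)]
  constructor
  · intro hM
    obtain ⟨e⟩ := exists_equiv_twistedDual (M := M) (σ := σ) (τ := τ) fun _ => rfl
    exact (HasDominantDim.twistedDual (M := dual K M) (σ := τ) (τ := σ) (fun _ => rfl)
      (fun _ => rfl) hM).of_equiv e.symm
  · exact HasCodominantDim.twistedDual (σ := σ) (τ := τ) (fun _ => rfl) fun _ => rfl

attribute [local instance] ModuleCat.moduleOfAlgebraModule
attribute [local instance] ModuleCat.isScalarTower_of_algebra_moduleCat

/-- The dual of the regular module is a cogenerator. -/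
theorem isCogeneratedBy_twistedDual (h' : ∀ s, (τ (σ s).unop).unop = s) :
    IsCogeneratedBy S X (twistedDual σ (ModuleCat.of R R)) := by
  intro x hx
  obtain ⟨f, hf⟩ : ∃ f : Module.Dual K X, f x ≠ 0 := by
    by_contra! hc
    exact hx ((Module.forall_dual_apply_eq_zero_iff K x).1 hc)
  have key : ∀ (M : ModuleCat.{u} R) (m : M) (g : M →ₗ[R] twistedDual τ X), g m = ofForm τ f →
      ∃ k : X →ₗ[S] twistedDual σ M, k x ≠ 0 := fun M m g hg =>
    ⟨twistedTranspose h' g, fun h0 => hf (by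
      have : form τ (g m) x = 0 := LinearMap.congr_fun (congrArg (form σ) h0) m
      rwa [hg] at this)⟩
  exact key (ModuleCat.of R R) (1 : R) (LinearMap.toSpanSingleton R _ (ofForm τ f))
    (one_smul R (ofForm τ f))

end DualityConsequences

/-! ### Left-right symmetry of basic algebras. -/

section SquareFreeDual

variable {A : Type u} [Ring A]

/-- A decomposition of the left regular module with a square summand yields one of the right regular
module. -/
theorem isSquareFree_regular (h : IsSquareFree Aᵐᵒᵖ A) : IsSquareFree A A := by
  rintro N ⟨s, p, hp⟩
  let s₁ : N → A := fun n => s (n, 0)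
  let s₂ : N → A := fun n => s (0, n)
  let n₁ : N := (p 1).1
  let n₂ : N := (p 1).2
  have hp' : ∀ a, p a = (a • n₁, a • n₂) := fun a => by
    rw [← mul_one a, ← smul_eq_mul, map_smul, smul_eq_mul, mul_one]; rfl
  have h11 : ∀ n, s₁ n • n₁ = n := fun n => congrArg Prod.fst ((hp' _).symm.trans (hp (n, 0)))
  have h12 : ∀ n, s₁ n • n₂ = 0 := fun n => congrArg Prod.snd ((hp' _).symm.trans (hp (n, 0)))
  have h21 : ∀ n, s₂ n • n₁ = 0 := fun n => congrArg Prod.fst ((hp' _).symm.trans (hp (0, n)))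
  have h22 : ∀ n, s₂ n • n₂ = n := fun n => congrArg Prod.snd ((hp' _).symm.trans (hp (0, n)))
  have hs₁ : ∀ a n, a * s₁ n = s₁ (a • n) := fun a n => by
    change a • s (n, 0) = s (a • n, 0); rw [← map_smul]; simp
  have hs₂ : ∀ a n, a * s₂ n = s₂ (a • n) := fun a n => by
    change a • s (0, n) = s (0, a • n); rw [← map_smul]; simp
  have hz₁ : s₁ 0 = 0 := map_zero s
  have hz₂ : s₂ 0 = 0 := map_zero s
  let lm : A → (A →ₗ[Aᵐᵒᵖ] A) := fun y =>
    { toFun := fun x => y * x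
      map_add' := mul_add y
      map_smul' := fun c x => (mul_assoc y x c.unop).symm }
  -- `e` and `s₂ n₂` are the idempotents of the two copies of `N`, while `s₁ n₂` and `s₂ n₁` act as
  -- matrix units between them. Hence `eA ⊕ eA` is a summand of the right regular module, which
  -- forces `e = 0`.
  let e : A := s₁ n₁
  have hee : ∀ x, e * (e * x) = e * x := fun x => by
    rw [← mul_assoc]; simp only [e]; rw [hs₁, h11]
  let U : Submodule Aᵐᵒᵖ A := LinearMap.range (lm e)
  have hU : ∀ x : U, e * (x : A) = x := by
    rintro ⟨_, x, rfl⟩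
    exact hee x
  have e12 : ∀ x, e * (s₂ n₁ * x) = s₂ n₁ * x := fun x => by
    rw [← mul_assoc, hs₂, h11]
  have hsub : Subsingleton U := by
    refine h (ModuleCat.of Aᵐᵒᵖ U) ⟨U.subtype.coprod (lm (s₁ n₂) ∘ₗ U.subtype),
      ((lm e).rangeRestrict).prod (LinearMap.codRestrict U (lm (s₂ n₁)) fun x => ⟨_, e12 x⟩), ?_⟩
    rintro ⟨x, y⟩
    have hx := hU x
    have hy := hU y
    refine Prod.ext (Subtype.ext ?_) (Subtype.ext ?_)
    · change e * ((x : A) + s₁ n₂ * y) = x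
      rw [mul_add, hx, ← mul_assoc, hs₁, h12, hz₁, zero_mul, add_zero]
    · change s₂ n₁ * ((x : A) + s₁ n₂ * y) = y
      rw [mul_add, ← mul_assoc, hs₁, h22, hy, ← hx, ← mul_assoc, hs₁, h21, hz₁, zero_mul, zero_add]
  have he : e = 0 := by
    have := congrArg Subtype.val (Subsingleton.elim (⟨e * 1, 1, rfl⟩ : U) 0)
    simpa using this
  have h0 : ∀ n : N, n = 0 := fun n => by
    rw [← h11 n, ← h11 n₁, show s₁ n₁ = 0 from he, zero_smul, smul_zero]
  exact ⟨fun a b => (h0 a).trans (h0 b).symm⟩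

end SquareFreeDual

/-! ### Cosyzygies of the regular module. -/

section Cosyzygies

variable {R : Type u} [Ring R] {G : ModuleCat.{u} R} {I : Coresolution G} {r : ℕ}

open Coresolution

theorem Coresolution.IsMinimalInjective.projDim_cosyzygy (hG : Module.Projective R G)
    (hP : ∀ j < r, Module.Projective R (I.X j)) {j : ℕ} (hj : j ≤ r) :
    HasProjectiveDimensionLE (I.cosyzygy j) j := by
  induction j with
  | zero =>
    obtain ⟨e⟩ := I.nonempty_equiv_cosyzygy_zero
    exact projDim_zero_iff.2 (.of_equiv e)
  | succ j ih =>
    exact (I.isExtension_cosyzygy j).projDim_right (ih (by lia))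
      (HasProjectiveDimensionLE.mono (projDim_zero_iff.2 (hP j (by lia))) (Nat.zero_le _))

theorem Coresolution.IsMinimalInjective.injective_cosyzygy (hI : I.IsMinimalInjective)
    (hG : HasInjectiveDimensionLE G r) : Module.Injective R (I.cosyzygy r) := by
  have key : ∀ j s, j + s = r → HasInjectiveDimensionLE (I.cosyzygy j) s := by
    intro j
    induction j with
    | zero =>
      rintro s rfl
      obtain ⟨e⟩ := I.nonempty_equiv_cosyzygy_zero
      rw [zero_add] at hG
      exact (ModuleCat.hasInjectiveDimensionLE_iff_of_linearEquiv e s).1 hG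
    | succ j ih =>
      intro s hs
      have := hI.module_injective j
      exact (I.isExtension_cosyzygy j).injDim_right (ih (s + 1) (by lia))
  exact injDim_zero_iff.1 (key r 0 rfl)

/-- Climbing from `j` to `r` through projective terms raises the degree of Ext by `s = r - j`. -/
theorem Coresolution.extZero_cosyzygy_left (hP : ∀ j < r, Module.Projective R (I.X j))
    {T : ModuleCat.{u} R} {d : ℕ} (hT : HasInjectiveDimensionLE T d) {j s : ℕ} (hj : j + s = r)
    (k : ℕ) (hk : d ≤ s + k) : ExtZero (I.cosyzygy j) T (k + 1) := by
  induction s generalizing j k with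
  | zero => exact HasInjectiveDimensionLE.extZero hT (k + 1) (by lia)
  | succ s ih =>
    have := hP j (by lia)
    exact (I.isExtension_cosyzygy j).extZero_shift' (ih (by lia) (k + 1) (by lia))

/-- Descending from `j` to `G` through injective terms raises the degree of Ext by `j`. -/
theorem Coresolution.IsMinimalInjective.extZero_cosyzygy_right (hI : I.IsMinimalInjective)
    {T : ModuleCat.{u} R} {d : ℕ} (hT : HasProjectiveDimensionLE T d) {j : ℕ} (k : ℕ)
    (hk : d ≤ j + k) : ExtZero T (I.cosyzygy j) (k + 1) := by
  induction j generalizing k with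
  | zero => exact HasProjectiveDimensionLE.extZero hT (k + 1) (by lia)
  | succ j ih =>
    have := hI.module_injective j
    exact (I.isExtension_cosyzygy j).extZero_shift (ih (k + 1) (by lia))

theorem Coresolution.hasCodominantDim_cosyzygy (hP : ∀ j < r, IsFiniteProjInj R (I.X j))
    {j : ℕ} (hj : j ≤ r) : HasCodominantDim j (I.cosyzygy j) := by
  induction j with
  | zero => trivial
  | succ j ih => exact ⟨_, _, hP j (by lia), I.isExtension_cosyzygy j, ih (by lia)⟩

theorem Coresolution.isCoresolvedBy_cosyzygy {T : ModuleCat.{u} R} {n j : ℕ}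
    (hT : AddOf R T (I.cosyzygy (j + n))) (hX : ∀ k < j + n, AddOf R T (I.X k)) :
    IsCoresolvedBy T n (I.cosyzygy j) := by
  induction n generalizing j with
  | zero => exact hT
  | succ n ih =>
    have h : j + (n + 1) = j + 1 + n := by lia
    rw [h] at hT hX
    exact ⟨_, _, I.isExtension_cosyzygy j, hX j (by lia), ih hT hX⟩

variable [IsNoetherianRing R] [IsArtinianRing R]

theorem Coresolution.IsMinimalInjective.isSquareFree_cosyzygy (hI : I.IsMinimalInjective)
    (hG : IsSquareFree R G) (hP : ∀ j < r, IsFiniteProjInj R (I.X j)) {j : ℕ} (hj : j ≤ r) :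
    IsSquareFree R (I.cosyzygy j) := by
  induction j with
  | zero =>
    obtain ⟨e⟩ := I.nonempty_equiv_cosyzygy_zero
    exact hG.of_isRetract (.of_equiv e.symm)
  | succ j ih =>
    obtain ⟨_, _, _⟩ := hP j (by lia)
    have := (I.isExtension_cosyzygy j).finite_right
    exact (ih (by lia)).of_exact (Submodule.subtype_injective _) (I.exact_toCosyzygy j)
      (I.toCosyzygy_surjective j) (hI.essential_cosyzygy j)

/-- For `j = 0` the product would contain the square of every common summand of `Q` and `G`; for `j
≥ 1` the cosyzygy is the cokernel of an essential embedding and has no projective summand. -/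
theorem Coresolution.IsMinimalInjective.isSquareFree_prod_cosyzygy (hI : I.IsMinimalInjective)
    (hG : IsSquareFree R G) (hP : ∀ j < r, IsFiniteProjInj R (I.X j)) {j : ℕ} (hj : 1 ≤ j)
    (hjr : j ≤ r) {Q : ModuleCat.{u} R} (hQ : IsFiniteProjInj R Q) (hQ' : IsSquareFree R Q) :
    IsSquareFree R (Q × I.cosyzygy j) := by
  obtain ⟨j, rfl⟩ := Nat.exists_eq_add_of_le' hj
  obtain ⟨_, _, _⟩ := hP j (by lia)
  obtain ⟨_, _, _⟩ := hQ
  have := (I.isExtension_cosyzygy j).finite_right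
  exact (hI.isSquareFree_cosyzygy hG hP (by lia)).prod_of_exact (Submodule.subtype_injective _)
    (I.exact_toCosyzygy j) (I.toCosyzygy_surjective j) (hI.essential_cosyzygy j) hQ'

/-- From the first cosyzygy on there are no projective summands, so cosyzygies sit superfluously in
the next projective term. Thus this part of the injective resolution is also a minimal projective
resolution. -/
theorem Coresolution.IsMinimalInjective.isSuperfluous_cosyzygy (hI : I.IsMinimalInjective)
    (hP : ∀ j < r, IsFiniteProjInj R (I.X j)) {j : ℕ} (hj : 1 ≤ j) (hjr : j < r) :
    IsSuperfluous (LinearMap.ker (I.toCosyzygy j)) := by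
  obtain ⟨j, rfl⟩ := Nat.exists_eq_add_of_le' hj
  obtain ⟨_, _, _⟩ := hP (j + 1) hjr
  have h : HasNoProjectiveRetract R (I.cosyzygy (j + 1)) :=
    (hI.essential_cosyzygy j).hasNoProjectiveRetract (I.exact_toCosyzygy j)
      (I.toCosyzygy_surjective j)
  have h' := h.isSuperfluous_range (LinearMap.ker (I.d (j + 1))).subtype
  rwa [Submodule.range_subtype, ← ker_toCosyzygy] at h'

theorem Coresolution.IsMinimalInjective.isSyzygy_cosyzygy (hI : I.IsMinimalInjective)
    [Module.Finite R G] (hP : ∀ j < r, IsFiniteProjInj R (I.X j)) {j : ℕ} (hj : 1 ≤ j) {n : ℕ}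
    (hn : j + n ≤ r) : IsSyzygy n (I.cosyzygy (j + n)) (I.cosyzygy j) := by
  induction n with
  | zero =>
    obtain ⟨j, rfl⟩ := Nat.exists_eq_add_of_le' hj
    obtain ⟨_, _, _⟩ := hP j (by lia)
    have := (I.isExtension_cosyzygy j).finite_right
    exact isSyzygy_zero _
  | succ n ih =>
    obtain ⟨_, _, _⟩ := hP (j + n) (by lia)
    exact IsSyzygy.succ (L := I.cosyzygy (j + n)) (M := I.cosyzygy (j + n + 1))
      (Submodule.subtype_injective _) (I.exact_toCosyzygy _)
      (I.toCosyzygy_surjective _) (hI.isSuperfluous_cosyzygy hP (by lia) (by lia)) (ih (by lia))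

/-- The cover of `Q × Y_r` is `Q × I (r - 1)` with kernel the cosyzygy `Y_(r-1)`, so `Q` contributes
only to the first step. This is why `j < r` is required. -/
theorem Coresolution.IsMinimalInjective.isSyzygy_prod (hI : I.IsMinimalInjective)
    [Module.Finite R G] (hP : ∀ j < r, IsFiniteProjInj R (I.X j)) {j : ℕ} (hj : 1 ≤ j)
    (hjr : j < r) {Q D : ModuleCat.{u} R} (hQ : IsFiniteProjInj R Q)
    (e : (Q × I.cosyzygy r) ≃ₗ[R] D) : IsSyzygy (r - j) D (I.cosyzygy j) := by
  obtain ⟨n, rfl⟩ : ∃ n, r = j + n + 1 := ⟨r - j - 1, by lia⟩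
  obtain ⟨_, _, _⟩ := hP (j + n) (by lia)
  obtain ⟨_, _, _⟩ := hQ
  have hs := hI.isSyzygy_cosyzygy hP hj (n := n) (by lia)
  rw [show j + n + 1 - j = n + 1 by lia]
  let g : Q × I.X (j + n) →ₗ[R] Q × I.cosyzygy (j + n + 1) :=
    (LinearMap.id (M := Q)).prodMap (I.toCosyzygy (j + n))
  have hker : ∀ x, g x = 0 ↔ x.1 = 0 ∧ I.toCosyzygy (j + n) x.2 = 0 := fun x => Prod.ext_iff
  refine IsSyzygy.succ (L := I.cosyzygy (j + n)) (P := ModuleCat.of R (Q × I.X (j + n)))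
    (f := .inr R Q _ ∘ₗ (LinearMap.ker (I.d (j + n))).subtype) (g := e.toLinearMap ∘ₗ g)
    (LinearMap.inr_injective.comp (Submodule.subtype_injective _)) (fun x => ?_)
    (e.surjective.comp (Function.Surjective.prodMap Function.surjective_id
      (I.toCosyzygy_surjective _))) ?_ hs
  · rw [LinearMap.comp_apply, LinearEquiv.coe_coe, LinearEquiv.map_eq_zero_iff, hker,
      I.exact_toCosyzygy (j + n) x.2]
    constructor
    · rintro ⟨h1, y, hy⟩
      exact ⟨y, Prod.ext h1.symm hy⟩
    · rintro ⟨y, rfl⟩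
      exact ⟨rfl, y, rfl⟩
  · refine ((hI.isSuperfluous_cosyzygy hP (j := j + n) (by lia) (by lia)).map
      (.inr R Q (I.X (j + n)))).mono ?_
    intro x hx
    rw [LinearMap.mem_ker, LinearMap.comp_apply, LinearEquiv.coe_coe, LinearEquiv.map_eq_zero_iff,
      hker] at hx
    exact ⟨x.2, hx.2, Prod.ext hx.1.symm rfl⟩

end Cosyzygies

/-! ### Modules without maps to the cogenerating terms. -/

section Cogenerator

variable {R : Type u} [Ring R] {G : ModuleCat.{u} R} {I : Coresolution G} {r : ℕ}

open Coresolution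

/-- For an element killed by every map to `E`, test the cyclic submodule it generates: since `E` is
injective, every map from it to `E` extends to `M` and therefore vanishes. -/
theorem isCogeneratedBy_of_forall {M E : ModuleCat.{u} R} [Module.Injective R E]
    (h : ∀ N : ModuleCat.{u} R, Module.Finite R N → (∃ f : N →ₗ[R] M,
      Function.Injective f) → ExtZero N E 0 → Subsingleton N) : IsCogeneratedBy R M E := by
  intro x hx
  by_contra! hc
  let N := Submodule.span R {x}
  have hsub : Subsingleton N := by
    refine h (ModuleCat.of R N) (Module.Finite.span_singleton R x)
      ⟨N.subtype, N.subtype_injective⟩ (extZero_zero_iff.2 fun f => ?_)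
    obtain ⟨g, hg⟩ := Module.Injective.out N.subtype N.subtype_injective f
    ext ⟨y, hy⟩
    obtain ⟨c, rfl⟩ := Submodule.mem_span_singleton.1 hy
    rw [← hg]
    simp [hc g]
  exact hx (congrArg Subtype.val (Subsingleton.elim
    (⟨x, Submodule.mem_span_singleton_self x⟩ : N) 0))

/-- Each syzygy step raises the degree by one, which is why vanishing on `G` is needed in all
degrees even when only degree zero is wanted. -/
theorem extZero_of_projDim [IsNoetherianRing R] {N M : ModuleCat.{u} R} (e : R ≃ₗ[R] G)
    (hN : ∀ k, ExtZero N G k) [Module.Finite R M] {d : ℕ} (hM : HasProjectiveDimensionLE M d)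
    (k : ℕ) : ExtZero N M k := by
  have hfree : ∀ (P : ModuleCat.{u} R) (m : ℕ), IsRetract R P (Fin m → R) → ∀ k, ExtZero N P k :=
    fun P m hP k => (hN k).addOf_right (AddOf.trans ⟨m, hP⟩ (.of_isRetract (.of_equiv e)))
  induction d generalizing M k with
  | zero =>
    have := projDim_zero_iff.1 hM
    obtain ⟨m, f, hf⟩ := Module.Finite.exists_fin' R M
    exact hfree M m (.of_surjective f hf) k
  | succ d ih =>
    obtain ⟨m, f, hf⟩ := Module.Finite.exists_fin' R M
    have hex := isExtension_ker (X := ModuleCat.of R (Fin m → R)) hf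
    have : Module.Finite R (ModuleCat.of R (Fin m → R)) :=
      inferInstanceAs (Module.Finite R (Fin m → R))
    have : Module.Projective R (ModuleCat.of R (Fin m → R)) :=
      inferInstanceAs (Module.Projective R (Fin m → R))
    have := hex.finite_left
    exact hex.extZero_right (hfree _ m .refl k) (ih (hex.projDim_left hM) (k + 1))

/-- Descending induction from the injective cosyzygy `Y_r`: degree zero vanishes since `Y_j` embeds
into `I.X j`, and higher degrees reduce to `Y_(j+1)`. -/
theorem Coresolution.IsMinimalInjective.extZero_all (hI : I.IsMinimalInjective)
    (hG : HasInjectiveDimensionLE G r) {N : ModuleCat.{u} R} (hX : ∀ j < r, ExtZero N (I.X j) 0)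
    (hr : ExtZero N (I.cosyzygy r) 0) (k : ℕ) : ExtZero N G k := by
  have key : ∀ s j, j + s = r → ∀ k, ExtZero N (I.cosyzygy j) k := by
    intro s
    induction s with
    | zero =>
      rintro j rfl k
      cases k with
      | zero => exact hr
      | succ k =>
        have := hI.injective_cosyzygy hG
        exact extZero_of_injective k
    | succ s ih =>
      intro j hj k
      cases k with
      | zero =>
        refine extZero_zero_iff.2 fun f => ?_
        have := extZero_zero_iff.1 (hX j (by lia)) ((LinearMap.ker (I.d j)).subtype ∘ₗ f)
        ext x
        exact LinearMap.congr_fun this x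
      | succ k =>
        have := hI.module_injective j
        exact (I.isExtension_cosyzygy j).extZero_left (ih (j + 1) (by lia) k)
          (extZero_of_injective k)
  obtain ⟨e⟩ := I.nonempty_equiv_cosyzygy_zero
  exact (key r 0 (zero_add r) k).retract_right (.of_equiv e)

end Cogenerator

/-! ### Right modules, `eA` and `D(A)`. -/

section RightModules

variable {K A : Type u} [Field K] [Ring A] [Algebra K A]

/-- The regular right module as a module over the opposite ring. -/
def regularEquiv (A : Type u) [Ring A] : Aᵐᵒᵖ ≃ₗ[Aᵐᵒᵖ] rightRegular A where
  toFun a := a.unop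
  invFun a := .op a
  map_add' _ _ := rfl
  map_smul' _ _ := rfl
  left_inv _ := rfl
  right_inv _ := rfl

theorem InAdd.addOf {T M : ModuleCat.{u} Aᵐᵒᵖ} (h : InAdd T M) : AddOf Aᵐᵒᵖ T M := by
  obtain ⟨n, ⟨f⟩⟩ := h
  exact ⟨n, f.i.hom, f.r.hom, fun x => LinearMap.congr_fun (congrArg ModuleCat.Hom.hom f.retract) x⟩

theorem IsTilting.isCoresolvedBy {T : ModuleCat.{u} Aᵐᵒᵖ} (h : IsTilting T) :
    ∃ n, IsCoresolvedBy T n (rightRegular A) := by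
  obtain ⟨C, n, hT, hn⟩ := h.coresolution
  have key : ∀ s j, j + s = n → IsCoresolvedBy T s (C.cosyzygy j) := by
    intro s
    induction s with
    | zero =>
      rintro j rfl
      -- The term after the last one is zero, so the last cosyzygy is the whole last term.
      have := hn (j + 1) (by lia)
      refine AddOf.retract ?_ (hT j).addOf
      have : LinearMap.ker (C.d j) = ⊤ := LinearMap.ker_eq_top.2 (Subsingleton.elim _ _)
      exact .of_equiv (LinearEquiv.ofTop _ this)
    | succ s ih =>
      intro j hj
      exact ⟨_, _, C.isExtension_cosyzygy j, (hT j).addOf, ih (j + 1) (by lia)⟩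
  obtain ⟨e⟩ := C.nonempty_equiv_cosyzygy_zero
  have h0 := key n 0 (zero_add n)
  refine ⟨n, ?_⟩
  cases n with
  | zero => exact AddOf.retract (.of_equiv e) h0
  | succ n =>
    obtain ⟨Y, Z, hex, hY, hZ⟩ := h0
    exact ⟨Y, Z, hex.of_equiv_left e, hY, hZ⟩

theorem isRetract_rightIdeal {e : A} (he : IsIdempotentElem e) :
    IsRetract Aᵐᵒᵖ (rightIdeal e) (rightRegular A) := by
  let p : A →ₗ[Aᵐᵒᵖ] Submodule.span Aᵐᵒᵖ ({e} : Set A) :=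
    { toFun := fun x => ⟨e * x, Submodule.mem_span_singleton.2 ⟨.op x, rfl⟩⟩
      map_add' := fun x y => Subtype.ext (mul_add e x y)
      map_smul' := fun c x => Subtype.ext (mul_assoc e x c.unop).symm }
  refine ⟨(Submodule.span Aᵐᵒᵖ ({e} : Set A)).subtype, p, ?_⟩
  rintro ⟨x, hx⟩
  obtain ⟨c, rfl⟩ := Submodule.mem_span_singleton.1 hx
  refine Subtype.ext ?_
  change e * (e * c.unop) = e * c.unop
  rw [← mul_assoc, he.eq]

/-- A projective module is cogenerated by any faithful module. -/
theorem isCogeneratedBy_of_faithful {R : Type u} [Ring R] {E P : ModuleCat.{u} R}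
    [FaithfulSMul R E] [Module.Projective R P] [Module.Finite R P] : IsCogeneratedBy R P E := by
  intro x hx
  obtain ⟨n, f, hf⟩ := Module.Finite.exists_fin' R P
  obtain ⟨s, p, hp⟩ := IsRetract.of_surjective f hf
  obtain ⟨i, hi⟩ : ∃ i, s x i ≠ 0 := by
    by_contra! hc
    exact hx (by rw [← hp x, show s x = 0 from funext hc, map_zero])
  obtain ⟨y, hy⟩ : ∃ y : E, s x i • y ≠ 0 := by
    by_contra! hc
    exact hi (FaithfulSMul.eq_of_smul_eq_smul (α := E) fun y => by rw [hc y, zero_smul])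
  exact ⟨LinearMap.toSpanSingleton R E y ∘ₗ LinearMap.proj (φ := fun _ => R) i ∘ₗ s, hy⟩

theorem isCogeneratedBy_dualRegular {X : ModuleCat.{u} Aᵐᵒᵖ} :
    IsCogeneratedBy Aᵐᵒᵖ X (dualRegular K A) :=
  isCogeneratedBy_twistedDual (K := K) (σ := (AlgEquiv.refl : Aᵐᵒᵖ ≃ₐ[K] Aᵐᵒᵖ)) (τ := AlgEquiv.opOp K A) fun _ => rfl

variable (K A) in
theorem injective_dualRegular : Module.Injective Aᵐᵒᵖ (dualRegular K A) :=
  have : Module.Projective A (ModuleCat.of A A) := inferInstanceAs (Module.Projective A A)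
  injective_twistedDual (K := K) (σ := (AlgEquiv.refl : Aᵐᵒᵖ ≃ₐ[K] Aᵐᵒᵖ)) (τ := AlgEquiv.opOp K A)
    (M := ModuleCat.of A A) (fun _ => rfl) fun _ => rfl

section Dual

variable [Module.Finite K A]

variable (K A) in
theorem finite_dualRegular : Module.Finite Aᵐᵒᵖ (dualRegular K A) :=
  have : Module.Finite A (ModuleCat.of A A) := inferInstanceAs (Module.Finite A A)
  twistedDual.finite (K := K) (σ := (AlgEquiv.refl : Aᵐᵒᵖ ≃ₐ[K] Aᵐᵒᵖ)) (M := ModuleCat.of A A)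

theorem projDim_dualRegular {r : ℕ} (h : HasInjectiveDimensionLE (ModuleCat.of A A) r) :
    HasProjectiveDimensionLE (dualRegular K A) r :=
  have : Module.Finite K Aᵐᵒᵖ := inferInstance
  have : Module.Finite A (ModuleCat.of A A) := inferInstanceAs (Module.Finite A A)
  projDim_twistedDual (K := K) (σ := (AlgEquiv.refl : Aᵐᵒᵖ ≃ₐ[K] Aᵐᵒᵖ)) (τ := AlgEquiv.opOp K A)
    (fun _ => rfl) (fun _ => rfl) h

open twistedDual in
-- A square summand of `D(A)` dualizes to a square summand of the left regular module, where the
-- left-right symmetry applies.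
theorem isSquareFree_dualRegular (h : IsSquareFree Aᵐᵒᵖ A) :
    IsSquareFree Aᵐᵒᵖ (dualRegular K A) := by
  intro N hN
  let σ : Aᵐᵒᵖ ≃ₐ[K] Aᵐᵒᵖ := AlgEquiv.refl
  let τ : A ≃ₐ[K] Aᵐᵒᵖᵐᵒᵖ := AlgEquiv.opOp K A
  have : Module.Finite K Aᵐᵒᵖ := inferInstance
  have : Module.Finite A (ModuleCat.of A A) := inferInstanceAs (Module.Finite A A)
  have := finite_dualRegular K A
  have hfin : Module.Finite Aᵐᵒᵖ N := (IsRetract.fst.trans hN).finite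
  obtain ⟨e⟩ := exists_equiv_twistedDual (M := ModuleCat.of A A) (σ := σ) (τ := τ) fun _ => rfl
  let P : ModuleCat.{u} Aᵐᵒᵖ := ModuleCat.of Aᵐᵒᵖ (N × N)
  let π₁ : P →ₗ[Aᵐᵒᵖ] N := .fst Aᵐᵒᵖ N N
  let π₂ : P →ₗ[Aᵐᵒᵖ] N := .snd Aᵐᵒᵖ N N
  let ι₁ : N →ₗ[Aᵐᵒᵖ] P := .inl Aᵐᵒᵖ N N
  let ι₂ : N →ₗ[Aᵐᵒᵖ] P := .inr Aᵐᵒᵖ N N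
  have h11 : ∀ x, π₁ (ι₁ x) = x := fun x => rfl
  have h12 : ∀ x, π₁ (ι₂ x) = 0 := fun x => rfl
  have h21 : ∀ x, π₂ (ι₁ x) = 0 := fun x => rfl
  have h22 : ∀ x, π₂ (ι₂ x) = x := fun x => rfl
  have h1 : IsRetract A (twistedDual τ N × twistedDual τ N) (twistedDual τ P) := by
    refine ⟨(twistedDualMap τ π₁).coprod (twistedDualMap τ π₂),
      (twistedDualMap τ ι₁).prod (twistedDualMap τ ι₂), ?_⟩
    rintro ⟨a, b⟩
    refine Prod.ext (twistedDual.ext fun x => ?_) (twistedDual.ext fun x => ?_)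
    · simp [h11, h21]
    · simp [h12, h22]
  have h2 : IsRetract A (twistedDual τ P) (twistedDual τ (dualRegular K A)) :=
    IsRetract.twistedDual (σ := τ) hN
  have h3 := isSquareFree_regular h (twistedDual τ N) (h1.trans (h2.trans (.of_equiv e.symm)))
  obtain ⟨e'⟩ := exists_equiv_twistedDual (M := N) (σ := τ) (τ := σ) fun _ => rfl
  have : Subsingleton (twistedDual σ (twistedDual τ N)) := by
    refine ⟨fun a b => twistedDual.ext fun x => ?_⟩
    rw [Subsingleton.elim x 0, map_zero, map_zero]
  exact e'.injective.subsingleton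

end Dual

end RightModules

/-! ### Identification of `T` and of `D(A)`. -/

section Main

variable {K A : Type u} [Field K] [Ring A] [Algebra K A] [Module.Finite K A]
  {I : Coresolution (rightRegular A)} {r i : ℕ} {Q : ModuleCat.{u} Aᵐᵒᵖ}

/-- `Q × Y_i` is self-orthogonal and coresolves the ring, so the orthogonality criterion applies in
both directions and gives equal additive closures; square-freeness turns this into an isomorphism.
-/
theorem nonempty_equiv_of_extZero (hI : I.IsMinimalInjective)
    (hA : IsSquareFree Aᵐᵒᵖ A) (hP : ∀ j < r, IsFiniteProjInj Aᵐᵒᵖ (I.X j))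
    (hQ : IsFiniteProjInj Aᵐᵒᵖ Q) (hQA : IsSquareFree Aᵐᵒᵖ Q)
    (hQadd : ∀ P : ModuleCat.{u} Aᵐᵒᵖ, IsFiniteProjInj Aᵐᵒᵖ P → AddOf Aᵐᵒᵖ Q P)
    (hi : 1 ≤ i) (hir : i ≤ r) {T : ModuleCat.{u} Aᵐᵒᵖ} (hT : IsBasicTiltingCotilting K T)
    (h1 : ∀ k, ExtZero T (I.cosyzygy i) (k + 1)) (h2 : ∀ k, ExtZero (I.cosyzygy i) T (k + 1)) :
    Nonempty (T ≃ₗ[Aᵐᵒᵖ] Q × I.cosyzygy i) := by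
  have hK : Module.Finite K Aᵐᵒᵖ := inferInstance
  have : IsNoetherianRing Aᵐᵒᵖ := isNoetherian_of_tower K inferInstance
  have : IsArtinianRing Aᵐᵒᵖ := isArtinian_of_tower K inferInstance
  have hAproj : Module.Projective Aᵐᵒᵖ (rightRegular A) := .of_equiv (regularEquiv A)
  have hAfin : Module.Finite Aᵐᵒᵖ (rightRegular A) := .equiv (regularEquiv A)
  have := hT.tilting.finite
  obtain ⟨_, _, _⟩ := hQ
  have hYfin : Module.Finite Aᵐᵒᵖ (I.cosyzygy i) :=
    (hI.finite (hasFiniteInjectives K Aᵐᵒᵖ) i).1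
  let U : ModuleCat.{u} Aᵐᵒᵖ := ModuleCat.of Aᵐᵒᵖ (Q × I.cosyzygy i)
  have hU : IsExtension Q U (I.cosyzygy i) := .prod _ _
  have hUfin : Module.Finite Aᵐᵒᵖ U := inferInstanceAs (Module.Finite Aᵐᵒᵖ (Q × I.cosyzygy i))
  have hY : HasProjectiveDimensionLE (I.cosyzygy i) i :=
    Coresolution.IsMinimalInjective.projDim_cosyzygy hAproj (fun j hj => (hP j hj).projective) hir
  have hQU : AddOf Aᵐᵒᵖ U Q := .of_isRetract .fst
  have hUpd : HasProjectiveDimensionLE U i := by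
    obtain ⟨f, g, hf, hfg, hg⟩ := hU
    exact (shortExact_of_exact hf hfg hg).hasProjectiveDimensionLT_X₂ (i + 1)
      (HasProjectiveDimensionLE.mono (projDim_zero_iff.2 ‹_›) (Nat.zero_le _)) hY
  have hTU : ∀ k, ExtZero T U (k + 1) := fun k =>
    hU.extZero_mid (extZero_of_injective k) (h1 k)
  have hUT : ∀ k, ExtZero U T (k + 1) := fun k =>
    hU.extZero_mid' (extZero_of_projective k) (h2 k)
  have hUU : ∀ k, ExtZero U U (k + 1) := fun k =>
    hU.extZero_mid' (extZero_of_projective k)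
      (hU.extZero_mid (extZero_of_injective k) (hI.extZero_cosyzygy_right hY k (by lia)))
  have hTT : ∀ k, ExtZero T T (k + 1) := fun k => hT.tilting.ext_self (k + 1) (by lia)
  obtain ⟨n, hn⟩ := hT.tilting.isCoresolvedBy
  obtain ⟨d, hd⟩ := hT.tilting.projdim
  obtain ⟨e⟩ := I.nonempty_equiv_cosyzygy_zero
  have hUA : IsCoresolvedBy U i (I.cosyzygy 0) := by
    refine Coresolution.isCoresolvedBy_cosyzygy ?_ fun k hk => ?_
    · rw [zero_add]
      exact .of_isRetract .snd
    · exact (hQadd _ (hP k (by lia))).trans hQU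
  have hadd : AddOf Aᵐᵒᵖ T U := addOf_of_isCoresolvedBy K hTT (regularEquiv A) hn hTU hUT hUpd
  have hadd' : AddOf Aᵐᵒᵖ U T :=
    addOf_of_isCoresolvedBy K hUU ((regularEquiv A).trans e) hUA hUT hTU hd
  exact hT.basic.isSquareFree.nonempty_equiv
    (hI.isSquareFree_prod_cosyzygy hA hP hi hir ⟨‹_›, ‹_›, ‹_›⟩ hQA) hadd hadd'

theorem nonempty_dualRegular_equiv (hI : I.IsMinimalInjective)
    (hA : IsSquareFree Aᵐᵒᵖ A) (hP : ∀ j < r, IsFiniteProjInj Aᵐᵒᵖ (I.X j))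
    (hQ : IsFiniteProjInj Aᵐᵒᵖ Q) (hQA : IsSquareFree Aᵐᵒᵖ Q)
    (hQadd : ∀ P : ModuleCat.{u} Aᵐᵒᵖ, IsFiniteProjInj Aᵐᵒᵖ P → AddOf Aᵐᵒᵖ Q P) (hr : 1 ≤ r)
    (hinj : HasInjectiveDimensionLE (rightRegular A) r)
    (hinj' : HasInjectiveDimensionLE (ModuleCat.of A A) r) :
    Nonempty ((Q × I.cosyzygy r) ≃ₗ[Aᵐᵒᵖ] dualRegular K A) := by
  have hK : Module.Finite K Aᵐᵒᵖ := inferInstance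
  have : IsNoetherianRing Aᵐᵒᵖ := isNoetherian_of_tower K inferInstance
  have : IsArtinianRing Aᵐᵒᵖ := isArtinian_of_tower K inferInstance
  have hAfin : Module.Finite Aᵐᵒᵖ (rightRegular A) := .equiv (regularEquiv A)
  have := finite_dualRegular K A
  have := injective_dualRegular K A
  obtain ⟨_, _, _⟩ := hQ
  have hYfin : Module.Finite Aᵐᵒᵖ (I.cosyzygy r) :=
    (hI.finite (hasFiniteInjectives K Aᵐᵒᵖ) r).1
  have hYinj := hI.injective_cosyzygy hinj
  let U : ModuleCat.{u} Aᵐᵒᵖ := ModuleCat.of Aᵐᵒᵖ (Q × I.cosyzygy r)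
  have hUfin : Module.Finite Aᵐᵒᵖ U := inferInstanceAs (Module.Finite Aᵐᵒᵖ (Q × I.cosyzygy r))
  have hUinj : Module.Injective Aᵐᵒᵖ U := inferInstanceAs (Module.Injective Aᵐᵒᵖ (Q × I.cosyzygy r))
  have h1 : AddOf Aᵐᵒᵖ (dualRegular K A) U := .of_isCogeneratedBy isCogeneratedBy_dualRegular
  have h2 : AddOf Aᵐᵒᵖ U (dualRegular K A) := by
    refine .of_isCogeneratedBy (isCogeneratedBy_of_forall ?_)
    -- No maps to `Q` or to `Y_r` means that all Ext from `N` to the ring vanish, hence also all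
    -- maps to `D(A)`, which has finite projective dimension by the left injective dimension of `A`.
    -- The embedding `f` is then zero.
    rintro N _ ⟨f, hf⟩ hN
    have hNQ : ExtZero N Q 0 := hN.addOf_right (.of_isRetract .fst)
    have hNA := hI.extZero_all hinj (fun j hj => hNQ.addOf_right (hQadd _ (hP j hj)))
      (hN.addOf_right (.of_isRetract .snd))
    have hND := extZero_of_projDim (regularEquiv A) hNA (projDim_dualRegular (K := K) hinj') 0
    have hf0 := extZero_zero_iff.1 hND f
    exact ⟨fun a b => hf (by rw [hf0]; simp)⟩
  exact (hI.isSquareFree_prod_cosyzygy hA hP hr le_rfl ⟨‹_›, ‹_›, ‹_›⟩ hQA).nonempty_equiv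
    (isSquareFree_dualRegular hA) h2 h1

/-- The `n`-th cosyzygy has finite projective dimension, hence at most `r`; each
projective-injective term on the way back lowers the bound by one. -/
theorem HasDominantDim.projDim_le {T : ModuleCat.{u} Aᵐᵒᵖ} [Module.Finite Aᵐᵒᵖ T]
    [IsNoetherianRing Aᵐᵒᵖ] (hinj : HasInjectiveDimensionLE (rightRegular A) r) {n d : ℕ}
    (h : HasDominantDim n T) (hd : HasProjectiveDimensionLE T d) (hn : n ≤ r) :
    HasProjectiveDimensionLE T (r - n) := by
  obtain ⟨Z, _, hZ, hZT⟩ := h.exists_cosyzygy hd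
  exact hZT r hn (projDim_le_of_injDim (regularEquiv A) hinj hZ)

end Main

end AuslanderGorenstein

open AuslanderGorenstein in
theorem mainTheorem9 {K A : Type u} [Field K] [Ring A] [Algebra K A] [Module.Finite K A]
    (hA : IsBasic (rightRegular A))
    (r : ℕ) (hr : IsAuslanderGorenstein A r)
    (e : A) (he : IsIdempotentElem e) (heinj : Injective (rightIdeal e))
    (hemin : IsMinimalFaithful (R := Aᵐᵒᵖ) (rightIdeal e))
    (i : ℕ) (hi : 1 ≤ i) (hir : i ≤ r)
    (T : ModuleCat.{u} Aᵐᵒᵖ) (hT : IsBasicTiltingCotilting K T)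
    (hpd : projectiveDimension T = (i : WithBot ℕ∞))
    (hid : injectiveDimension T = ((r - i : ℕ) : WithBot ℕ∞)) :
    domDim T = ((r - i : ℕ) : ℕ∞) ∧ codomDim K T = (i : ℕ∞) ∧
    (∃ N : ModuleCat.{u} Aᵐᵒᵖ, IsCosyzygy i (rightRegular A) N ∧
      Nonempty (T ≅ ModuleCat.of Aᵐᵒᵖ (rightIdeal e × N))) ∧
    (i < r → ∃ N : ModuleCat.{u} Aᵐᵒᵖ, IsSyzygy (r - i) (dualRegular K A) N ∧
      Nonempty (T ≅ ModuleCat.of Aᵐᵒᵖ (rightIdeal e × N))) ∧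
    (i = r → Nonempty (T ≅ dualRegular K A)) ∧
    IsUniqueBasicTiltingCotilting K (fun M => Dom (r - i) M ∧ Codom K i M) T ∧
    IsUniqueBasicTiltingCotilting K (fun M => Proj i M ∧ Codom K i M) T ∧
    IsUniqueBasicTiltingCotilting K (fun M => Inj (r - i) M ∧ Dom (r - i) M) T := by
  have hKA : Module.Finite K Aᵐᵒᵖ := inferInstance
  have : IsNoetherianRing Aᵐᵒᵖ := isNoetherian_of_tower K inferInstance
  have : IsArtinianRing Aᵐᵒᵖ := isArtinian_of_tower K inferInstance
  have hAproj : Module.Projective Aᵐᵒᵖ (rightRegular A) := .of_equiv (regularEquiv A)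
  have hAfin : Module.Finite Aᵐᵒᵖ (rightRegular A) := .equiv (regularEquiv A)
  have hRinj := hasFiniteInjectives K Aᵐᵒᵖ
  have hAsf : IsSquareFree Aᵐᵒᵖ A := hA.isSquareFree
  have hinj : HasInjectiveDimensionLE (rightRegular A) r :=
    (injectiveDimension_le_iff _ _).1 hr.injdim_right.le
  have hinj' : HasInjectiveDimensionLE (ModuleCat.of A A) r :=
    (injectiveDimension_le_iff _ _).1 hr.injdim_left.le
  have hQ : IsFiniteProjInj Aᵐᵒᵖ (rightIdeal e) :=
    ⟨(isRetract_rightIdeal he).finite, (isRetract_rightIdeal he).projective, injective_iff.1 heinj⟩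
  have hQsf : IsSquareFree Aᵐᵒᵖ (rightIdeal e) := hAsf.of_isRetract (isRetract_rightIdeal he)
  -- Faithfulness of `eA` makes it cogenerate every finitely generated projective; when that
  -- projective is also injective, the embedding into a power of `eA` splits.
  have hQadd : ∀ P : ModuleCat.{u} Aᵐᵒᵖ, IsFiniteProjInj Aᵐᵒᵖ P → AddOf Aᵐᵒᵖ (rightIdeal e) P := by
    rintro P ⟨_, _, _⟩
    have := hemin.1
    exact .of_isCogeneratedBy (isCogeneratedBy_of_faithful (E := rightIdeal e))
  obtain ⟨I, hI⟩ := hRinj.exists_minimal_coresolution (rightRegular A)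
  obtain ⟨e₀⟩ := I.nonempty_equiv_cosyzygy_zero
  have hP : ∀ j < r, IsFiniteProjInj Aᵐᵒᵖ (I.X j) := fun j hj => by
    have h := (le_domDim_iff hRinj (rightRegular A) r).1 hr.domDim_eq.ge
    have h' := hI.projective_of_hasDominantDim (h.of_equiv e₀.symm) j hj
    rw [zero_add] at h'
    exact ⟨(hI.finite hRinj j).2, h', hI.module_injective j⟩
  have hPp : ∀ j < r, Module.Projective Aᵐᵒᵖ (I.X j) := fun j hj => (hP j hj).projective
  have hY : HasProjectiveDimensionLE (I.cosyzygy i) i :=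
    Coresolution.IsMinimalInjective.projDim_cosyzygy hAproj hPp hir
  -- The two alternatives are the two ways of killing Ext from `Y_i` to `T'`; between them they
  -- cover the given `T` and all three classes.
  have hequiv : ∀ T' : ModuleCat.{u} Aᵐᵒᵖ, IsBasicTiltingCotilting K T' →
      HasProjectiveDimensionLE T' i →
      (HasCodominantDim i T' ∨ HasInjectiveDimensionLE T' (r - i)) →
      Nonempty (T' ≃ₗ[Aᵐᵒᵖ] rightIdeal e × I.cosyzygy i) := by
    intro T' hT' hp hc
    refine nonempty_equiv_of_extZero hI hAsf hP hQ hQsf hQadd hi hir hT'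
      (fun k => hI.extZero_cosyzygy_right hp k (by lia)) fun k => ?_
    rcases hc with hc | hc
    · exact hc.extZero hY k (by lia)
    · exact Coresolution.extZero_cosyzygy_left hPp hc (s := r - i) (by lia) k (by lia)
  have hTp : HasProjectiveDimensionLE T i := (projectiveDimension_le_iff _ _).1 hpd.le
  have hTi : HasInjectiveDimensionLE T (r - i) := (injectiveDimension_le_iff _ _).1 hid.le
  have hTfin := hT.tilting.finite
  obtain ⟨u⟩ := hequiv T hT hTp (.inr hTi)
  -- Exceeding either claimed dimension would make `T` projective, which `i ≥ 1` excludes.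
  have hTnp : ¬ Module.Projective Aᵐᵒᵖ T := fun h => by
    have := (projectiveDimension_le_iff T 0).2 (projDim_zero_iff.2 h)
    rw [hpd] at this
    have : i ≤ 0 := by exact_mod_cast this
    lia
  have hdom : HasDominantDim (r - i) T := by
    refine HasDominantDim.of_equiv (HasDominantDim.prod hQ (hI.hasDominantDim hRinj
      (n := r - i) (j := i) fun k hk => hPp _ (by lia))) u
  have hcod : HasCodominantDim i T :=
    HasCodominantDim.of_equiv (HasCodominantDim.prod hQ
      (Coresolution.hasCodominantDim_cosyzygy hP hir)) u.symm
  have hdom' : ((r - i : ℕ) : ℕ∞) ≤ domDim T := (le_domDim_iff hRinj T _).2 hdom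
  have hcod' : (i : ℕ∞) ≤ codomDim K T := (le_codomDim_iff K _).2 hcod
  have hunique : ∀ T' : ModuleCat.{u} Aᵐᵒᵖ, IsBasicTiltingCotilting K T' →
      HasProjectiveDimensionLE T' i →
      (HasCodominantDim i T' ∨ HasInjectiveDimensionLE T' (r - i)) → Nonempty (T' ≅ T) := by
    intro T' hT' hp hc
    obtain ⟨v⟩ := hequiv T' hT' hp hc
    exact ⟨(v.trans u.symm).toModuleIso⟩
  -- Dominant dimension `r - i` bounds the projective dimension by `r - (r - i) = i`.
  have hDom : ∀ T' : ModuleCat.{u} Aᵐᵒᵖ, IsBasicTiltingCotilting K T' → Dom (r - i) T' →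
      HasProjectiveDimensionLE T' i := by
    rintro T' hT' ⟨_, h⟩
    obtain ⟨d, hd⟩ := hT'.tilting.projdim
    have := ((le_domDim_iff hRinj T' _).1 h).projDim_le hinj hd (by lia)
    rwa [show r - (r - i) = i by lia] at this
  have hCodom : ∀ T' : ModuleCat.{u} Aᵐᵒᵖ, Codom K i T' → HasCodominantDim i T' := by
    rintro T' ⟨_, h⟩
    exact (le_codomDim_iff K _).1 h
  obtain ⟨v⟩ := nonempty_dualRegular_equiv (K := K) hI hAsf hP hQ hQsf hQadd (by lia) hinj hinj'
  refine ⟨le_antisymm ?_ hdom', le_antisymm ?_ hcod', ⟨I.cosyzygy i, ⟨I, hI, ⟨.refl _ _⟩⟩,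
    ⟨u.toModuleIso⟩⟩, fun h => ⟨I.cosyzygy i, hI.isSyzygy_prod hP hi h hQ v, ⟨u.toModuleIso⟩⟩,
    fun h => ?_, ⟨⟨hT, ⟨hTfin, hdom'⟩, hTfin, hcod'⟩, fun T' hT' h => ?_⟩,
    ⟨⟨hT, ⟨hTfin, hTp⟩, hTfin, hcod'⟩, fun T' hT' h => ?_⟩,
    ⟨⟨hT, ⟨hTfin, hTi⟩, hTfin, hdom'⟩, fun T' hT' h => ?_⟩⟩
  · by_contra! h
    have h' : ((r - i + 1 : ℕ) : ℕ∞) ≤ domDim T := by exact_mod_cast Order.add_one_le_of_lt h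
    exact hTnp (((le_domDim_iff hRinj T _).1 h').projective_of_injDim hTi)
  · by_contra! h
    have h' : ((i + 1 : ℕ) : ℕ∞) ≤ codomDim K T := by exact_mod_cast Order.add_one_le_of_lt h
    exact hTnp (((le_codomDim_iff K _).1 h').projective_of_projDim hTp)
  · subst h
    exact ⟨(u.trans v).toModuleIso⟩
  · exact hunique T' hT' (hDom T' hT' h.1) (.inl (hCodom T' h.2))
  · exact hunique T' hT' h.1.2 (.inl (hCodom T' h.2))
  · exact hunique T' hT' (hDom T' hT' h.2) (.inr h.1.2)
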